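/- Let $K$ be an infinite field, $S=K[x_1,\ldots,x_n]$ the standard graded polynomial ring, and $M$ a finitely generated $\mathbb Z$-graded $S$-module. For $i\ge 0$ let $\beta_i(M)=\dim_K\operatorname{Tor}_i^S(K,M)$, where $K=S/(x_1,\ldots,x_n)$. For a sequence $y=y_1,\ldots,y_n$ of linear forms and $1\le p\le n$ put $$A_p(y)=\bigl((y_1,\ldots,y_{p-1})M:_M y_p\bigr)/(y_1,\ldots,y_{p-1})M .$$ The generic annihilator number $\alpha_p(M)$ is the dimension $\dim_K A_p(y)$ for a generic sequence $y$. It is well defined: there is a nonempty Zariski open subset of the space $K^{n\times n}$ of coefficient matrices of sequences of $n$ linear forms on which $\dim_K A_p(y)$ is finite and constant, equal to $\alpha_p(M)$. Suppose that for some $i\ge 1$ $$\beta_i(M)=\sum_{j=1}^{n-i+1}\binom{n-j}{i-1}\alpha_j(M).$$ Then $$\beta_k(M)=\sum_{j=1}^{n-k+1}\binom{n-j}{k-1}\alpha_j(M)\qquad\text{for all } k\ge i .$$ (Empty sums are zero.) -/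

import Mathlib

open CategoryTheory

universe u

/-- The graded maximal ideal `(x_1, …, x_n)` of `S = K[x_1, …, x_n]`. -/
noncomputable def gradedMaximalIdeal (K : Type u) [Field K] (n : ℕ) : Ideal (MvPolynomial (Fin n) K) :=
  Ideal.span (Set.range MvPolynomial.X)

/-- The `i`-th Betti number `dim_K Tor_i^S(K, M)`, where `K = S / (x_1, …, x_n)`.
`Tor'` is Mathlib's `Tor` computed from a projective resolution of the first argument. -/
noncomputable def bettiNumber (K : Type u) [Field K] (n : ℕ)
    (M : Type u) [AddCommGroup M] [Module (MvPolynomial (Fin n) K) M] (i : ℕ) : ℕ :=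
  Module.finrank K
    ((ModuleCat.restrictScalars (MvPolynomial.C : K →+* MvPolynomial (Fin n) K)).obj
      (((Tor' (ModuleCat.{u} (MvPolynomial (Fin n) K)) i).obj
        (ModuleCat.of (MvPolynomial (Fin n) K)
          (MvPolynomial (Fin n) K ⧸ gradedMaximalIdeal K n))).obj
        (ModuleCat.of (MvPolynomial (Fin n) K) M)))

section Annihilator

variable {R : Type*} [CommRing R] (M : Type*) [AddCommGroup M] [Module R M] {n : ℕ}

/-- The submodule `(y_q : q < p) M` of `M`. -/
def initialSubmodule (y : Fin n → R) (p : Fin n) : Submodule R M :=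
  Ideal.span (y '' {q | q < p}) • (⊤ : Submodule R M)

/-- The colon submodule `{m ∈ M | y_p m ∈ (y_q : q < p) M}`. -/
def colonSubmodule (y : Fin n → R) (p : Fin n) : Submodule R M :=
  (initialSubmodule M y p).comap (LinearMap.lsmul R M (y p))

/-- The module `((y_q : q < p) M :_M y_p) / (y_q : q < p) M`. -/
abbrev annihilatorModule (y : Fin n → R) (p : Fin n) : Type _ :=
  colonSubmodule M y p ⧸ (initialSubmodule M y p).submoduleOf (colonSubmodule M y p)

end Annihilator

/-- The sequence of linear forms `y_p = ∑_q c_{p q} x_q` with coefficient matrix `c`. -/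
noncomputable def linearForms {K : Type u} [Field K] {n : ℕ} (c : Fin n × Fin n → K) (p : Fin n) :
    MvPolynomial (Fin n) K :=
  ∑ q : Fin n, MvPolynomial.C (c (p, q)) * MvPolynomial.X q

/-- Over an infinite field: `P` holds for generic sequences of `n` linear forms in `n` variables,
i.e. for all coefficient matrices in some nonempty Zariski open set. It suffices to consider basic
open sets, the loci where a nonzero polynomial `g` in the coefficients does not vanish. -/
def ForGenericCoeffs {K : Type u} [Field K] {n : ℕ} (P : (Fin n × Fin n → K) → Prop) : Prop :=
  ∃ g : MvPolynomial (Fin n × Fin n) K, g ≠ 0 ∧ ∀ c, MvPolynomial.eval c g ≠ 0 → P c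

section Generic

variable (K : Type u) [Field K] (n : ℕ) (M : Type u) [AddCommGroup M] [Module K M]
  [Module (MvPolynomial (Fin n) K) M] [IsScalarTower K (MvPolynomial (Fin n) K) M]

/-- For generic linear forms `y`, the module `((y_q : q < p) M :_M y_p) / (y_q : q < p) M` is
finite-dimensional over `K`, of dimension `a`. -/
def IsGenericAnnihilatorNumber (p : Fin n) (a : ℕ) : Prop :=
  ForGenericCoeffs fun c : Fin n × Fin n → K =>
    Module.Finite K (annihilatorModule M (linearForms c) p) ∧
      Module.finrank K (annihilatorModule M (linearForms c) p) = a

open Classical in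
/-- The generic annihilator numbers of `M`, indexed from zero: for `p : Fin n` this is
`α_{p+1}(M)`. -/
noncomputable def genericAnnihilatorNumber (p : Fin n) : ℕ :=
  if h : ∃ a, IsGenericAnnihilatorNumber K n M p a then h.choose else 0

/-- The number `∑_{j=1}^{n-i+1} (n-j choose i-1) α_j(M)`, for `i ≥ 1`. The summation index here is
`j - 1`, and the condition `j ≤ n - i + 1` reads `(j - 1) + i ≤ n`. -/
noncomputable def bettiBound (i : ℕ) : ℕ :=
  ∑ j ∈ Finset.univ.filter (fun j : Fin n => (j : ℕ) + i ≤ n),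
    (n - ((j : ℕ) + 1)).choose (i - 1) * genericAnnihilatorNumber K n M j

end Generic

/-! Write H_i(p) for the Koszul homology of M with respect to the first p forms of y. Adding the
next form z gives an exact sequence H_i(p) → H_i(p) → H_i(p+1) → H_{i-1}(p) → H_{i-1}(p) whose outer
maps are multiplication by z (`ker_inclusionMap`, `ker_contractMap`, `range_contractMap`). On
H_0(p), the quotient of M by the first p forms, the kernel of z is the annihilator module of y
(`annihilatorModuleEquiv`). Hence dim H_1(p+1) is dim H_1(p) plus an annihilator number minus one
rank, and for i ≥ 2, dim H_i(p+1) is dim H_i(p) + dim H_{i-1}(p) minus two ranks. Discarding the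
ranks and using Pascal's rule bounds dim H_i(n) by the binomial sum. Equality for one i forces
equality for every p ≤ n and makes every multiplication on H_i(p), p < n, zero (`eq_of_recursion`).

The heart is a rigidity statement, `smul_mem_boundaries_succ`: if for each p < n the next form kills
H_i(p), then for each p < n it kills H_{i+1}(p). The recursion for i + 1 then loses nothing either,
and equality propagates upwards (`finrank_homology_eq_of_le`).

Two bridges lead to the theorem. When the coefficient matrix is invertible, the forms are a linear
change of the variables, so their Koszul complex resolves K and its homology with coefficients in M
is Tor (`bettiNumber_eq_finrank_homology`). The generic annihilator numbers are well defined
(`exists_isGenericAnnihilatorNumber`) by working over B = K[c], with c the matrix of indeterminate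
coefficients. The kernel of the generic form on the generic quotient of M[c] is killed by powers of
each x_q, hence is finite over B. Generic freeness makes this kernel commute with specialization on
a nonempty open set, where its dimension is the size of a maximal independent subset. As K is
infinite, one matrix c satisfies all the open conditions at once. -/

namespace Koszul

/-! ### Exterior calculus, Koszul cycles and boundaries -/

section Operators

variable {R : Type*} [CommRing R] {M : Type*} [AddCommGroup M] [Module R M] {n : ℕ}

/-- The sign `(-1)^k`, where `k` is the number of elements of `A` below `r`. -/
def sign (r : Fin n) (A : Finset (Fin n)) : ℤ := (-1) ^ (A.filter (· < r)).card

theorem sign_mul_self (r : Fin n) (A : Finset (Fin n)) : sign r A * sign r A = 1 := by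
  rw [sign, ← mul_pow]; norm_num

theorem sign_insert {r s : Fin n} {A : Finset (Fin n)} (h : s ∉ A) :
    sign r (insert s A) = (if s < r then -1 else 1) * sign r A := by
  unfold sign
  rw [Finset.filter_insert]
  split_ifs with hs
  · rw [Finset.card_insert_of_notMem (by simp [h]), pow_succ']
  · rw [one_mul]

variable (R M) in
/-- Contraction of an `M`-valued exterior form with the `r`-th coordinate functional. A form is
given by its coefficients, indexed by finite sets of coordinates. -/
def contract (r : Fin n) : (Finset (Fin n) → M) →ₗ[R] (Finset (Fin n) → M) where
  toFun f A := if r ∈ A then 0 else sign r A • f (insert r A)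
  map_add' f g := by ext A; simp only [Pi.add_apply]; split_ifs <;> simp
  map_smul' a f := by
    ext A; simp only [Pi.smul_apply, RingHom.id_apply]; split_ifs
    · simp
    · exact smul_comm _ _ _

variable (R M) in
/-- Left multiplication of an `M`-valued exterior form by the `r`-th basis vector. -/
def wedge (r : Fin n) : (Finset (Fin n) → M) →ₗ[R] (Finset (Fin n) → M) where
  toFun f A := if r ∈ A then sign r (A.erase r) • f (A.erase r) else 0
  map_add' f g := by ext A; simp only [Pi.add_apply]; split_ifs <;> simp
  map_smul' a f := by
    ext A; simp only [Pi.smul_apply, RingHom.id_apply]; split_ifs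
    · exact smul_comm _ _ _
    · simp

theorem contract_apply (r : Fin n) (f : Finset (Fin n) → M) (A : Finset (Fin n)) :
    contract R M r f A = if r ∈ A then 0 else sign r A • f (insert r A) := rfl

theorem wedge_apply (r : Fin n) (f : Finset (Fin n) → M) (A : Finset (Fin n)) :
    wedge R M r f A = if r ∈ A then sign r (A.erase r) • f (A.erase r) else 0 := rfl

theorem contract_contract_self (r : Fin n) (f : Finset (Fin n) → M) :
    contract R M r (contract R M r f) = 0 := by
  ext A; simp [contract_apply]

theorem contract_contract (r s : Fin n) (f : Finset (Fin n) → M) :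
    contract R M r (contract R M s f) = - contract R M s (contract R M r f) := by
  rcases eq_or_ne r s with rfl | hrs
  · simp [contract_contract_self]
  ext A
  simp only [contract_apply, Finset.mem_insert, Pi.neg_apply]
  by_cases hr : r ∈ A
  · simp [hr]
  by_cases hs : s ∈ A
  · simp [hs]
  simp only [hr, hs, hrs, hrs.symm, or_self, if_false, sign_insert hr, sign_insert hs, smul_smul,
    Finset.insert_comm s r, ← neg_smul]
  congr 1
  rcases lt_or_gt_of_ne hrs with h | h
  · rw [if_pos h, if_neg h.asymm]; ring
  · rw [if_neg h.asymm, if_pos h]; ring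

/-- One summand keeps the coefficients on sets containing `r`, the other those on sets avoiding `r`.
This splitting replaces the decomposition of the exterior algebra when one basis vector is added. -/
theorem wedge_contract_add (r : Fin n) (f : Finset (Fin n) → M) :
    wedge R M r (contract R M r f) + contract R M r (wedge R M r f) = f := by
  ext A
  by_cases hr : r ∈ A
  · simp [contract_apply, wedge_apply, hr, smul_smul, sign_mul_self, Finset.insert_erase]
  · simp [contract_apply, wedge_apply, hr, smul_smul, sign_mul_self]

theorem contract_wedge {r s : Fin n} (hrs : r ≠ s) (f : Finset (Fin n) → M) :
    contract R M r (wedge R M s f) = - wedge R M s (contract R M r f) := by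
  ext A
  simp only [contract_apply, wedge_apply, Finset.mem_insert, Pi.neg_apply, hrs.symm, false_or,
    Finset.mem_erase, ne_eq, hrs, not_false_eq_true, true_and]
  by_cases hr : r ∈ A
  · simp [hr]
  by_cases hs : s ∈ A
  · obtain ⟨B, hsB, rfl⟩ : ∃ B, s ∉ B ∧ insert s B = A :=
      ⟨A.erase s, by simp, Finset.insert_erase hs⟩
    have hrB : r ∉ B := fun h => hr (Finset.mem_insert_of_mem h)
    have e : (insert r (insert s B)).erase s = insert r B := by
      rw [Finset.insert_comm, Finset.erase_insert (by simp [hrs.symm, hsB])]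
    simp only [hr, hs, if_true, if_false, e, Finset.erase_insert hsB, sign_insert hsB,
      sign_insert hrB, smul_smul, ← neg_smul]
    congr 1
    rcases lt_or_gt_of_ne hrs with h | h
    · rw [if_pos h, if_neg h.asymm]; ring
    · rw [if_neg h.asymm, if_pos h]; ring
  · simp [hr, hs]

/-- The Koszul differential of a sequence `y`. -/
def differential (y : Fin n → R) : (Finset (Fin n) → M) →ₗ[R] (Finset (Fin n) → M) :=
  ∑ r, y r • contract R M r

theorem differential_apply (y : Fin n → R) (f : Finset (Fin n) → M) :
    differential y f = ∑ r, y r • contract R M r f := by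
  simp [differential, LinearMap.sum_apply]

theorem contract_differential (y : Fin n → R) (r : Fin n) (f : Finset (Fin n) → M) :
    contract R M r (differential y f) = - differential y (contract R M r f) := by
  simp only [differential_apply, map_sum, map_smul, contract_contract r, smul_neg,
    Finset.sum_neg_distrib]

/-- The double sum cancels in pairs (r, s), (s, r) because contractions anticommute; the diagonal
terms vanish. -/
theorem differential_differential (y : Fin n → R) (f : Finset (Fin n) → M) :
    differential y (differential y f) = 0 := by
  simp only [differential_apply, map_sum, map_smul, Finset.smul_sum]
  rw [← Finset.sum_product']
  refine Finset.sum_involution (fun x _ => (x.2, x.1)) ?_ ?_ ?_ ?_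
  · rintro ⟨r, s⟩ -
    dsimp only
    rw [contract_contract r s, smul_neg, smul_neg, smul_smul, smul_smul, mul_comm, add_neg_cancel]
  · rintro ⟨r, s⟩ - h h'
    obtain rfl : s = r := congrArg Prod.fst h'
    exact h (by simp [contract_contract_self])
  · simp
  · simp

/-- Wedging with a basis vector is a homotopy between multiplication by `y r` and zero, so `y r`
kills Koszul homology once the vector `r` is available. -/
theorem differential_wedge (y : Fin n → R) (r : Fin n) (f : Finset (Fin n) → M) :
    differential y (wedge R M r f) = y r • f - wedge R M r (differential y f) := by
  have h : ∀ s, contract R M s (wedge R M r f) =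
      (if s = r then f else 0) - wedge R M r (contract R M s f) := by
    intro s
    split_ifs with h
    · subst h; rw [eq_sub_iff_add_eq, add_comm, wedge_contract_add]
    · rw [contract_wedge h, zero_sub]
  simp only [differential_apply, h, smul_sub, Finset.sum_sub_distrib, map_sum, map_smul]
  simp

variable (R M n) in
/-- The `M`-valued forms of degree `i` in the first `p` basis vectors. -/
def forms (i p : ℕ) : Submodule R (Finset (Fin n) → M) where
  carrier := {f | ∀ A, f A ≠ 0 → A.card = i ∧ ∀ a ∈ A, (a : ℕ) < p}
  zero_mem' := by simp
  add_mem' {f g} hf hg A h := by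
    by_cases h' : f A = 0
    · exact hg A fun h'' => h (by simp [h', h''])
    · exact hf A h'
  smul_mem' a f hf A h := hf A fun h' => h (by simp [h'])

theorem forms_mono {i p q : ℕ} (hpq : p ≤ q) : forms R M n i p ≤ forms R M n i q :=
  fun _ hf A h => ⟨(hf A h).1, fun a ha => ((hf A h).2 a ha).trans_le hpq⟩

theorem contract_mem {i p : ℕ} {f : Finset (Fin n) → M} (hf : f ∈ forms R M n (i + 1) p)
    (r : Fin n) : contract R M r f ∈ forms R M n i p := by
  intro A hA
  rw [contract_apply] at hA
  split_ifs at hA with hr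
  · exact absurd rfl hA
  obtain ⟨h1, h2⟩ := hf (insert r A) fun h => hA (by simp [h])
  rw [Finset.card_insert_of_notMem hr] at h1
  exact ⟨by omega, fun a ha => h2 a (Finset.mem_insert_of_mem ha)⟩

theorem contract_top_mem {i : ℕ} (r : Fin n) {f : Finset (Fin n) → M}
    (hf : f ∈ forms R M n (i + 1) (r + 1)) : contract R M r f ∈ forms R M n i r := by
  intro A hA
  refine ⟨(contract_mem hf r A hA).1, fun a ha => ?_⟩
  have h2 := (contract_mem hf r A hA).2 a ha
  rw [contract_apply] at hA
  split_ifs at hA with hr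
  · exact absurd rfl hA
  · have : a ≠ r := fun h => hr (h ▸ ha)
    have := Fin.val_ne_of_ne this
    omega

theorem contract_eq_zero {i p : ℕ} {f : Finset (Fin n) → M} (hf : f ∈ forms R M n i p)
    {r : Fin n} (hr : p ≤ r) : contract R M r f = 0 := by
  ext A
  rw [contract_apply]
  split_ifs with h
  · rfl
  by_contra h'
  have := (hf (insert r A) fun h'' => h' (by simp [h''])).2 r (Finset.mem_insert_self _ _)
  omega

theorem mem_forms_of_contract_eq_zero {i : ℕ} (r : Fin n) {f : Finset (Fin n) → M}
    (hf : f ∈ forms R M n i (r + 1)) (h : contract R M r f = 0) : f ∈ forms R M n i r := by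
  intro A hA
  refine ⟨(hf A hA).1, fun a ha => ?_⟩
  have h2 := (hf A hA).2 a ha
  have : a ≠ r := by
    rintro rfl
    have := congrFun h (A.erase a)
    rw [contract_apply, if_neg (by simp), Finset.insert_erase ha, Pi.zero_apply] at this
    have h3 := congrArg (sign a (A.erase a) • ·) this
    simp only [smul_smul, sign_mul_self, one_smul, smul_zero] at h3
    exact hA h3
  have := Fin.val_ne_of_ne this
  omega

theorem wedge_mem {i p : ℕ} {f : Finset (Fin n) → M} (hf : f ∈ forms R M n i p) {r : Fin n}
    (hr : (r : ℕ) < p) : wedge R M r f ∈ forms R M n (i + 1) p := by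
  intro A hA
  rw [wedge_apply] at hA
  split_ifs at hA with h
  · obtain ⟨h1, h2⟩ := hf (A.erase r) fun h => hA (by simp [h])
    rw [← Finset.card_erase_add_one h, h1]
    refine ⟨rfl, fun a ha => ?_⟩
    rcases eq_or_ne a r with rfl | h'
    · exact hr
    · exact h2 a (by simp [h', ha])
  · exact absurd rfl hA

theorem differential_mem (y : Fin n → R) {i p : ℕ} {f : Finset (Fin n) → M}
    (hf : f ∈ forms R M n (i + 1) p) : differential y f ∈ forms R M n i p := by
  rw [differential_apply]
  exact Submodule.sum_mem _ fun r _ => Submodule.smul_mem _ _ (contract_mem hf r)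

theorem differential_eq_zero (y : Fin n → R) {p : ℕ} {f : Finset (Fin n) → M}
    (hf : f ∈ forms R M n 0 p) : differential y f = 0 := by
  rw [differential_apply]
  refine Finset.sum_eq_zero fun r _ => ?_
  have : contract R M r f = 0 := by
    ext A
    rw [contract_apply]
    split_ifs with h
    · rfl
    by_contra h'
    have := (hf (insert r A) fun h'' => h' (by simp [h''])).1
    simp at this
  rw [this, smul_zero]

theorem eq_zero_of_mem_forms_zero {i : ℕ} {f : Finset (Fin n) → M}
    (hf : f ∈ forms R M n (i + 1) 0) : f = 0 := by
  ext A
  by_contra h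
  obtain ⟨h1, h2⟩ := hf A h
  obtain ⟨a, ha⟩ := Finset.card_pos.1 (by omega : 0 < A.card)
  exact absurd (h2 a ha) (by omega)

/-- A form in the first `r + 1` basis vectors is the sum of a form in the first `r` basis vectors
and of the product of the last one with its contraction. -/
theorem contract_wedge_top_mem {i : ℕ} (r : Fin n) {f : Finset (Fin n) → M}
    (hf : f ∈ forms R M n i (r + 1)) :
    contract R M r (wedge R M r f) ∈ forms R M n i r :=
  contract_top_mem r (wedge_mem hf (Nat.lt_succ_self _))

variable (M) in
/-- Koszul cycles of degree `i` in the first `p` basis vectors. -/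
def cycles (y : Fin n → R) (i p : ℕ) : Submodule R (Finset (Fin n) → M) :=
  forms R M n i p ⊓ LinearMap.ker (differential y)

variable (M) in
/-- Koszul boundaries of degree `i` in the first `p` basis vectors. -/
def boundaries (y : Fin n → R) (i p : ℕ) : Submodule R (Finset (Fin n) → M) :=
  (forms R M n (i + 1) p).map (differential y)

theorem mem_cycles {y : Fin n → R} {i p : ℕ} {f : Finset (Fin n) → M} :
    f ∈ cycles M y i p ↔ f ∈ forms R M n i p ∧ differential y f = 0 := Iff.rfl

theorem cycles_mono (y : Fin n → R) (i : ℕ) {p q : ℕ} (hpq : p ≤ q) :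
    cycles M y i p ≤ cycles M y i q :=
  inf_le_inf_right _ (forms_mono hpq)

theorem boundaries_mono (y : Fin n → R) (i : ℕ) {p q : ℕ} (hpq : p ≤ q) :
    boundaries M y i p ≤ boundaries M y i q :=
  Submodule.map_mono (forms_mono hpq)

theorem contract_mem_cycles {y : Fin n → R} {i p : ℕ} {f : Finset (Fin n) → M}
    (hf : f ∈ cycles M y (i + 1) p) (r : Fin n) : contract R M r f ∈ cycles M y i p :=
  ⟨contract_mem hf.1 r, by
    change differential y _ = 0
    rw [← neg_eq_zero, ← contract_differential, (mem_cycles.1 hf).2, map_zero]⟩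

theorem contract_top_mem_cycles {y : Fin n → R} {i : ℕ} (r : Fin n) {f : Finset (Fin n) → M}
    (hf : f ∈ cycles M y (i + 1) (r + 1)) : contract R M r f ∈ cycles M y i r :=
  ⟨contract_top_mem r hf.1, (contract_mem_cycles hf r).2⟩

theorem contract_top_mem_boundaries {y : Fin n → R} {i : ℕ} (r : Fin n) {f : Finset (Fin n) → M}
    (hf : f ∈ boundaries M y (i + 1) (r + 1)) : contract R M r f ∈ boundaries M y i r := by
  obtain ⟨g, hg, rfl⟩ := hf
  rw [contract_differential]
  exact neg_mem ⟨_, contract_top_mem r hg, rfl⟩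

/-- If `f` is a form whose contraction `ι_r f` is the boundary of `u`, then `f` is homologous to
a form in the first `r` basis vectors. -/
theorem add_differential_wedge_mem {y : Fin n → R} {i : ℕ} (r : Fin n) {f u : Finset (Fin n) → M}
    (hf : f ∈ forms R M n (i + 1) (r + 1)) (hu : u ∈ forms R M n (i + 1) r)
    (h : contract R M r f = differential y u) :
    f + differential y (wedge R M r u) ∈ forms R M n (i + 1) r := by
  refine mem_forms_of_contract_eq_zero r (add_mem hf (differential_mem y
    (wedge_mem (forms_mono (Nat.le_succ _) hu) (Nat.lt_succ_self _)))) ?_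
  have h1 := wedge_contract_add (R := R) r u
  rw [contract_eq_zero hu le_rfl, map_zero, zero_add] at h1
  rw [map_add, contract_differential, h1, h, add_neg_cancel]

/-- A cycle in the first `r` basis vectors which becomes a boundary after adding the next basis
vector is homologous to `y_r` times a cycle. -/
theorem exists_cycle_of_mem_boundaries_succ {y : Fin n → R} {i : ℕ} (r : Fin n)
    {f : Finset (Fin n) → M} (hf : f ∈ forms R M n i r) (hb : f ∈ boundaries M y i (r + 1)) :
    ∃ b ∈ cycles M y i r, f - y r • b ∈ boundaries M y i r := by
  obtain ⟨w, hw, rfl⟩ := hb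
  have hb : differential y (contract R M r w) = 0 := by
    rw [← neg_eq_zero, ← contract_differential]; exact contract_eq_zero hf le_rfl
  -- Split w = e_r ∧ ι_r w + w₀ with w₀ = ι_r(e_r ∧ w) free of e_r. Since ι_r w is a cycle, dw = y_r
  -- ι_r w + dw₀.
  refine ⟨contract R M r w, ⟨contract_top_mem r hw, hb⟩, _, contract_wedge_top_mem r hw, ?_⟩
  conv_rhs => rw [← wedge_contract_add (R := R) r w, map_add, differential_wedge,
    map_add, contract_contract_self, add_zero]
  have h2 : contract R M r (contract R M r (wedge R M r w)) = 0 := contract_contract_self _ _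
  rw [hb, map_zero, sub_zero]
  have h3 : contract R M r (wedge R M r (contract R M r w)) = contract R M r w := by
    have := wedge_contract_add (R := R) r (contract R M r w)
    rwa [contract_contract_self, map_zero, zero_add] at this
  rw [h3]
  abel

/-- The kernel of H_i(q) → H_i(q+1) is y_q H_i(q), which vanishes by assumption, so these maps are
injective and a boundary can be pulled down one basis vector at a time. -/
theorem mem_boundaries_of_mem_boundaries {y : Fin n → R} {i : ℕ}
    (hy : ∀ r : Fin n, ∀ z ∈ cycles M y i r, y r • z ∈ boundaries M y i r) {p q : ℕ} (hpq : p ≤ q)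
    (hq : q ≤ n) {f : Finset (Fin n) → M} (hf : f ∈ forms R M n i p)
    (hb : f ∈ boundaries M y i q) : f ∈ boundaries M y i p := by
  induction q, hpq using Nat.le_induction with
  | base => exact hb
  | succ q hpq ih =>
    refine ih (by omega) ?_
    obtain ⟨b, hbc, hb'⟩ :=
      exists_cycle_of_mem_boundaries_succ ⟨q, hq⟩ (forms_mono hpq hf) hb
    simpa using add_mem hb' (hy ⟨q, hq⟩ b hbc)

/-- If `y_r` annihilates the `i`-th Koszul homology of `y_0, …, y_{r-1}` for all `r`, then it
annihilates the `(i+1)`-st. -/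
theorem smul_mem_boundaries_succ {y : Fin n → R} {i : ℕ}
    (hy : ∀ r : Fin n, ∀ z ∈ cycles M y i r, y r • z ∈ boundaries M y i r) (p : Fin n)
    {z : Finset (Fin n) → M} (hz : z ∈ cycles M y (i + 1) p) :
    y p • z ∈ boundaries M y (i + 1) p := by
  -- Push y_p z, up to boundaries in the first p vectors, into fewer and fewer basis vectors; no
  -- nonzero form of positive degree survives at q = 0.
  have key : ∀ k q : ℕ, q + k = p → ∃ c ∈ cycles M y (i + 1) q,
      y p • z - c ∈ boundaries M y (i + 1) p := by
    intro k
    induction k with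
    | zero =>
      rintro q h
      obtain rfl : q = p := h
      exact ⟨y p • z, Submodule.smul_mem _ _ hz, by simp⟩
    | succ k ih =>
      intro q hq
      obtain ⟨c, hc, w, hw, hwc⟩ := ih (q + 1) (by omega)
      have hqn : q < n := by omega
      set r : Fin n := ⟨q, hqn⟩
      have h1 : contract R M r c = y p • contract R M r z + differential y (contract R M r w) := by
        have := congrArg (contract R M r) hwc
        rw [contract_differential, map_sub, map_smul, neg_eq_iff_eq_neg] at this
        rw [this]; abel
      -- The contraction of z is a cycle of degree i, where y_p is already known to act as zero.
      -- Injectivity then turns this into a boundary in the first q vectors, say du, and c + d(e_r ∧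
      -- u) no longer involves e_r.
      have h2 : contract R M r c ∈ boundaries M y i p := by
        rw [h1]
        exact add_mem (hy p _ (contract_mem_cycles hz r)) ⟨_, contract_mem hw r, rfl⟩
      obtain ⟨u, hu, hu'⟩ := mem_boundaries_of_mem_boundaries hy (by omega : q ≤ p) p.2.le
        (contract_top_mem r hc.1) h2
      refine ⟨_, ⟨add_differential_wedge_mem r hc.1 hu hu'.symm, ?_⟩, ?_⟩
      · change differential y _ = 0
        rw [map_add, differential_differential, add_zero]
        exact hc.2
      · rw [← sub_sub]
        refine sub_mem ⟨w, hw, hwc⟩ ⟨_, wedge_mem (forms_mono (by omega) hu) ?_, rfl⟩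
        change q < p
        omega
  obtain ⟨c, hc, h⟩ := key p 0 (by simp)
  rwa [eq_zero_of_mem_forms_zero hc.1, sub_zero] at h

end Operators

/-! ### The long exact sequence for adding one element -/

section Homology

variable {R : Type*} [CommRing R] (M : Type*) [AddCommGroup M] [Module R M] {n : ℕ}

/-- The `i`-th Koszul homology of `M` with respect to the first `p` elements of `y`. -/
abbrev homology (y : Fin n → R) (i p : ℕ) : Type _ :=
  cycles M y i p ⧸ (boundaries M y i p).submoduleOf (cycles M y i p)

variable {M}

theorem mkQ_eq_zero {y : Fin n → R} {i p : ℕ} {z : cycles M y i p} :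
    (Submodule.Quotient.mk z : homology M y i p) = 0 ↔ (z : Finset (Fin n) → M) ∈
      boundaries M y i p := by
  rw [Submodule.Quotient.mk_eq_zero]
  rfl

variable (M)

/-- The map in Koszul homology induced by the inclusion of the first `p` basis vectors into the
first `q`. -/
def inclusionMap (y : Fin n → R) (i : ℕ) {p q : ℕ} (hpq : p ≤ q) :
    homology M y i p →ₗ[R] homology M y i q :=
  Submodule.mapQ _ _ (Submodule.inclusion (cycles_mono y i hpq))
    fun _ hz => boundaries_mono y i hpq hz

/-- The map in Koszul homology induced by contraction with the last basis vector. -/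
def contractMap (y : Fin n → R) (i : ℕ) (r : Fin n) :
    homology M y (i + 1) (r + 1) →ₗ[R] homology M y i r :=
  Submodule.mapQ _ _ ((contract R M r).restrict fun _ hz => contract_top_mem_cycles r hz)
    fun _ hz => contract_top_mem_boundaries r hz

/-- Multiplication by `y_r` on Koszul homology. -/
abbrev smulMap (y : Fin n → R) (i : ℕ) (r : Fin n) : homology M y i r →ₗ[R] homology M y i r :=
  LinearMap.lsmul R _ (y r)

variable {M}

theorem ker_inclusionMap (y : Fin n → R) (i : ℕ) (r : Fin n) :
    LinearMap.ker (inclusionMap M y i (Nat.le_succ r)) = LinearMap.range (smulMap M y i r) := by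
  ext x
  obtain ⟨⟨z, hz⟩, rfl⟩ := Submodule.Quotient.mk_surjective _ x
  rw [LinearMap.mem_ker]
  change (Submodule.Quotient.mk _ : homology M y i (r + 1)) = 0 ↔ _
  rw [mkQ_eq_zero]
  constructor
  · intro h
    obtain ⟨b, hb, h'⟩ := exists_cycle_of_mem_boundaries_succ r hz.1 h
    refine ⟨Submodule.Quotient.mk ⟨b, hb⟩, ?_⟩
    rw [eq_comm, ← sub_eq_zero]
    change (Submodule.Quotient.mk _ : homology M y i r) = 0
    rw [mkQ_eq_zero]
    exact h'
  · rintro ⟨x, hx⟩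
    obtain ⟨⟨b, hb⟩, rfl⟩ := Submodule.Quotient.mk_surjective _ x
    rw [eq_comm, ← sub_eq_zero] at hx
    have h1 : z - y r • b ∈ boundaries M y i r := mkQ_eq_zero.1 hx
    have h2 : y r • b = differential y (wedge R M r b) := by
      rw [differential_wedge, (mem_cycles.1 hb).2, map_zero, sub_zero]
    have h3 : y r • b ∈ boundaries M y i (r + 1) :=
      ⟨_, wedge_mem (forms_mono (Nat.le_succ _) hb.1) (Nat.lt_succ_self _), h2.symm⟩
    simpa using add_mem (boundaries_mono y i (Nat.le_succ _) h1) h3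

/-- If the contraction of z is du, the correction d(e_r ∧ u) removes e_r from z without changing its
class; conversely, forms without e_r contract to zero. -/
theorem ker_contractMap (y : Fin n → R) (i : ℕ) (r : Fin n) :
    LinearMap.ker (contractMap M y i r) =
      LinearMap.range (inclusionMap M y (i + 1) (Nat.le_succ r)) := by
  ext x
  obtain ⟨⟨z, hz⟩, rfl⟩ := Submodule.Quotient.mk_surjective _ x
  rw [LinearMap.mem_ker]
  change (Submodule.Quotient.mk _ : homology M y i r) = 0 ↔ _
  rw [mkQ_eq_zero]
  constructor
  · rintro ⟨u, hu, hu'⟩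
    refine ⟨Submodule.Quotient.mk ⟨z + differential y (wedge R M r u),
      add_differential_wedge_mem r hz.1 hu hu'.symm, ?_⟩, ?_⟩
    · change differential y _ = 0
      rw [map_add, differential_differential, add_zero]
      exact hz.2
    · rw [← sub_eq_zero]
      change (Submodule.Quotient.mk _ : homology M y (i + 1) (r + 1)) = 0
      rw [mkQ_eq_zero]
      change z + differential y (wedge R M r u) - z ∈ _
      rw [add_sub_cancel_left]
      exact ⟨_, wedge_mem (forms_mono (Nat.le_succ _) hu) (Nat.lt_succ_self _), rfl⟩
  · rintro ⟨x, hx⟩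
    obtain ⟨⟨b, hb⟩, rfl⟩ := Submodule.Quotient.mk_surjective _ x
    rw [eq_comm, ← sub_eq_zero] at hx
    have h1 : z - b ∈ boundaries M y (i + 1) (r + 1) := mkQ_eq_zero.1 hx
    have h2 := contract_top_mem_boundaries r h1
    rwa [map_sub, contract_eq_zero hb.1 le_rfl, sub_zero] at h2

/-- If y_r z = du, then e_r ∧ z - u is a cycle contracting to z. Conversely, for a cycle b the form
y_r ι_r b is, up to sign, the boundary of the e_r-free part of b. -/
theorem range_contractMap (y : Fin n → R) (i : ℕ) (r : Fin n) :
    LinearMap.range (contractMap M y i r) = LinearMap.ker (smulMap M y i r) := by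
  ext x
  obtain ⟨⟨z, hz⟩, rfl⟩ := Submodule.Quotient.mk_surjective _ x
  rw [LinearMap.mem_ker]
  change _ ↔ (Submodule.Quotient.mk (y r • ⟨z, hz⟩) : homology M y i r) = 0
  rw [mkQ_eq_zero]
  change _ ↔ y r • z ∈ _
  constructor
  · rintro ⟨x, hx⟩
    obtain ⟨⟨b, hb⟩, rfl⟩ := Submodule.Quotient.mk_surjective _ x
    rw [eq_comm, ← sub_eq_zero] at hx
    have h1 : z - contract R M r b ∈ boundaries M y i r := mkQ_eq_zero.1 hx
    have h2 : y r • contract R M r b =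
        - differential y (contract R M r (wedge R M r b)) := by
      have h4 := differential_wedge y r b
      rw [(mem_cycles.1 hb).2, map_zero, sub_zero] at h4
      rw [← contract_differential, h4, map_smul]
    have h3 : y r • contract R M r b ∈ boundaries M y i r := by
      rw [h2]
      exact neg_mem ⟨_, contract_wedge_top_mem r hb.1, rfl⟩
    have h5 := add_mem (Submodule.smul_mem _ (y r) h1) h3
    rwa [← smul_add, sub_add_cancel] at h5
  · rintro ⟨u, hu, hu'⟩
    have h1 : contract R M r (wedge R M r z - u) = z := by
      have h2 := wedge_contract_add (R := R) r z
      rw [contract_eq_zero hz.1 le_rfl, map_zero, zero_add] at h2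
      rw [map_sub, contract_eq_zero hu le_rfl, sub_zero, h2]
    have h2 : wedge R M r z - u ∈ cycles M y (i + 1) (r + 1) := by
      refine ⟨sub_mem (wedge_mem (forms_mono (Nat.le_succ _) hz.1) (Nat.lt_succ_self _))
        (forms_mono (Nat.le_succ _) hu), ?_⟩
      change differential y _ = 0
      rw [map_sub, differential_wedge, (mem_cycles.1 hz).2, hu', map_zero, sub_zero, sub_self]
    refine ⟨Submodule.Quotient.mk ⟨_, h2⟩, ?_⟩
    change (Submodule.Quotient.mk (⟨contract R M r (wedge R M r z - u), _⟩ : cycles M y i r) :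
      homology M y i r) = _
    congr 2

theorem smulMap_eq_zero_iff {y : Fin n → R} {i : ℕ} {r : Fin n} :
    smulMap M y i r = 0 ↔ ∀ z ∈ cycles M y i r, y r • z ∈ boundaries M y i r := by
  constructor
  · intro h z hz
    have := LinearMap.congr_fun h (Submodule.Quotient.mk ⟨z, hz⟩)
    exact mkQ_eq_zero.1 this
  · intro h
    ext ⟨z, hz⟩
    exact mkQ_eq_zero.2 (h z hz)

theorem homology_subsingleton_zero (y : Fin n → R) (i : ℕ) :
    Subsingleton (homology M y (i + 1) 0) := by
  refine ⟨fun a b => ?_⟩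
  have : ∀ a : homology M y (i + 1) 0, a = 0 := by
    intro a
    obtain ⟨⟨z, hz⟩, rfl⟩ := Submodule.Quotient.mk_surjective _ a
    rw [mkQ_eq_zero]
    simp [eq_zero_of_mem_forms_zero hz.1]
  rw [this a, this b]

variable (R M n) in
/-- The map sending `m` to the form of degree `0` with value `m`. -/
def constLinearMap : M →ₗ[R] (Finset (Fin n) → M) := LinearMap.single R (fun _ => M) ∅

theorem constLinearMap_empty (m : M) : constLinearMap R M n m ∅ = m :=
  Pi.single_eq_same (M := fun _ : Finset (Fin n) => M) ∅ m

theorem constLinearMap_of_ne (m : M) {A : Finset (Fin n)} (hA : A ≠ ∅) :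
    constLinearMap R M n m A = 0 :=
  Pi.single_eq_of_ne (M := fun _ : Finset (Fin n) => M) hA m

theorem constLinearMap_mem (m : M) (p : ℕ) : constLinearMap R M n m ∈ forms R M n 0 p := by
  intro A hA
  have : A = ∅ := by
    by_contra h
    exact hA (constLinearMap_of_ne m h)
  subst this
  simp

theorem eq_constLinearMap {f : Finset (Fin n) → M} {p : ℕ} (hf : f ∈ forms R M n 0 p) :
    f = constLinearMap R M n (f ∅) := by
  ext A
  by_cases hA : A = ∅
  · subst hA; exact (constLinearMap_empty _).symm
  · refine Eq.trans ?_ (constLinearMap_of_ne _ hA).symm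
    by_contra h
    exact hA (Finset.card_eq_zero.1 (hf A h).1)

theorem contract_eq_constLinearMap {f : Finset (Fin n) → M} {p : ℕ} (hf : f ∈ forms R M n 1 p)
    (r : Fin n) : contract R M r f = constLinearMap R M n (f {r}) := by
  rw [eq_constLinearMap (contract_mem hf r)]
  simp [contract_apply, sign]

/-- This identifies H_0 with the quotient of M by the initial forms: the boundary of a 1-form is the
combination of its coefficients with the y_r. -/
theorem constLinearMap_mem_boundaries {y : Fin n → R} {p : Fin n} {m : M} :
    constLinearMap R M n m ∈ boundaries M y 0 p ↔ m ∈ initialSubmodule M y p := by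
  constructor
  · rintro ⟨f, hf, h⟩
    have h1 : m = ∑ r, y r • f {r} := by
      have h2 := congrFun h ∅
      simp only [differential_apply, contract_eq_constLinearMap hf, ← map_smul, ← map_sum] at h2
      rwa [constLinearMap_empty, constLinearMap_empty, eq_comm] at h2
    rw [h1]
    refine Submodule.sum_mem _ fun r _ => ?_
    by_cases h0 : f {r} = 0
    · simp [h0]
    · exact Submodule.smul_mem_smul (Ideal.subset_span
        ⟨r, (hf _ h0).2 r (Finset.mem_singleton_self r), rfl⟩) Submodule.mem_top
  · intro h
    rw [← Submodule.mem_comap (f := constLinearMap R M n)]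
    suffices h' : initialSubmodule M y p ≤
        (boundaries M y 0 p).comap (constLinearMap R M n) from h' h
    refine Submodule.smul_le.2 fun a ha m _ => ?_
    induction ha using Submodule.span_induction generalizing m with
    | zero => simp
    | add a b _ _ ha hb => rw [add_smul]; exact add_mem (ha m trivial) (hb m trivial)
    | smul c a _ ha =>
      rw [smul_eq_mul, mul_smul]; exact Submodule.smul_mem _ _ (ha m trivial)
    | mem a ha =>
      obtain ⟨r, hr, rfl⟩ := ha
      refine ⟨wedge R M r (constLinearMap R M n m), wedge_mem (constLinearMap_mem m _) hr, ?_⟩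
      rw [differential_wedge, differential_eq_zero y (constLinearMap_mem m p), map_zero, sub_zero,
        map_smul]

theorem constLinearMap_mem_cycles (y : Fin n → R) (m : M) (p : ℕ) :
    constLinearMap R M n m ∈ cycles M y 0 p :=
  ⟨constLinearMap_mem m p, differential_eq_zero y (constLinearMap_mem m p)⟩

variable (M) in
/-- The map from the colon submodule to the Koszul homology in degree `0`. -/
def colonToHomology (y : Fin n → R) (r : Fin n) :
    colonSubmodule M y r →ₗ[R] homology M y 0 r :=
  (Submodule.mkQ _) ∘ₗ ((constLinearMap R M n).codRestrict (cycles M y 0 r)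
    fun m => constLinearMap_mem_cycles y m r) ∘ₗ (colonSubmodule M y r).subtype

variable (M) in
/-- The annihilator module `((y_q : q < r) M :_M y_r) / (y_q : q < r) M` is the kernel of the
multiplication by `y_r` on the Koszul homology in degree `0`. -/
noncomputable def annihilatorModuleEquiv (y : Fin n → R) (r : Fin n) :
    annihilatorModule M y r ≃ₗ[R] LinearMap.ker (smulMap M y 0 r) := by
  refine (Submodule.quotEquivOfEq _ (LinearMap.ker (colonToHomology M y r)) ?_).trans
    ((colonToHomology M y r).quotKerEquivRange.trans (LinearEquiv.ofEq _ _ ?_))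
  · ext ⟨m, hm⟩
    rw [LinearMap.mem_ker]
    change m ∈ initialSubmodule M y r ↔ (Submodule.Quotient.mk _ : homology M y 0 r) = 0
    rw [mkQ_eq_zero]
    exact constLinearMap_mem_boundaries.symm
  · ext x
    obtain ⟨⟨z, hz⟩, rfl⟩ := Submodule.Quotient.mk_surjective _ x
    have h0 : (Submodule.Quotient.mk ⟨z, hz⟩ : homology M y 0 r) ∈
        LinearMap.ker (smulMap M y 0 r) ↔ z ∅ ∈ colonSubmodule M y r := by
      rw [LinearMap.mem_ker]
      change (Submodule.Quotient.mk (y r • ⟨z, hz⟩) : homology M y 0 r) = 0 ↔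
        y r • z ∅ ∈ initialSubmodule M y r
      rw [mkQ_eq_zero, ← constLinearMap_mem_boundaries, map_smul, ← eq_constLinearMap hz.1]
      rfl
    constructor
    · rintro ⟨⟨m, hm⟩, hx⟩
      rw [← hx]
      have hm' : y r • m ∈ initialSubmodule M y r := hm
      change (Submodule.Quotient.mk (y r • _) : homology M y 0 r) = 0
      rw [mkQ_eq_zero]
      change y r • constLinearMap R M n m ∈ _
      rw [← map_smul, constLinearMap_mem_boundaries]
      exact hm'
    · intro h
      refine ⟨⟨z ∅, h0.1 h⟩, ?_⟩
      change (Submodule.Quotient.mk (⟨constLinearMap R M n (z ∅), _⟩ : cycles M y 0 r) :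
        homology M y 0 r) = _
      congr 2
      exact (eq_constLinearMap hz.1).symm

end Homology

/-! ### Dimension recursion with rank corrections -/

section Dimension

/-- H is an extension of ker ν by coker μ. Only the kernel of ν is required to be finite, since C
will also be H_0, which may be infinite-dimensional. -/
theorem finite_and_finrank_of_exact {K A H C : Type*} [Field K] [AddCommGroup A] [Module K A]
    [AddCommGroup H] [Module K H] [AddCommGroup C] [Module K C] {μ : A →ₗ[K] A} {j : A →ₗ[K] H}
    {q : H →ₗ[K] C} {ν : C →ₗ[K] C} [Module.Finite K A] [Module.Finite K (LinearMap.ker ν)]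
    (h1 : LinearMap.ker j = LinearMap.range μ) (h2 : LinearMap.ker q = LinearMap.range j)
    (h3 : LinearMap.range q = LinearMap.ker ν) :
    Module.Finite K H ∧ Module.finrank K H + Module.finrank K (LinearMap.range μ) =
      Module.finrank K A + Module.finrank K (LinearMap.ker ν) := by
  have f1 : Module.Finite K (LinearMap.ker q) := by rw [h2]; infer_instance
  have f2 : Module.Finite K (LinearMap.range q) := by rw [h3]; infer_instance
  have f3 : Module.Finite K (H ⧸ LinearMap.ker q) := Module.Finite.equiv q.quotKerEquivRange.symm
  have f4 : Module.Finite K H := Module.Finite.of_submodule_quotient (LinearMap.ker q)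
  refine ⟨f4, ?_⟩
  have e1 := q.finrank_range_add_finrank_ker
  have e2 := j.finrank_range_add_finrank_ker
  rw [h3, h2] at e1
  rw [h1] at e2
  omega

variable (K : Type*) [Field K] {R : Type*} [CommRing R] [Algebra K R] {M : Type*} [AddCommGroup M]
  [Module K M] [Module R M] [IsScalarTower K R M] {n : ℕ}

/-- The rank of the multiplication by `y_r` on Koszul homology. -/
noncomputable def rankSMul (M : Type*) [AddCommGroup M] [Module K M] [Module R M]
    [IsScalarTower K R M] (y : Fin n → R) (i : ℕ) (r : Fin n) : ℕ :=
  Module.finrank K (LinearMap.range ((smulMap M y i r).restrictScalars K))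

theorem finite_and_finrank_homology_succ (y : Fin n → R) (i : ℕ) (r : Fin n)
    [Module.Finite K (homology M y (i + 1) r)]
    [h : Module.Finite K (LinearMap.ker ((smulMap M y i r).restrictScalars K))] :
    Module.Finite K (homology M y (i + 1) (r + 1)) ∧
    Module.finrank K (homology M y (i + 1) (r + 1)) + rankSMul K M y (i + 1) r =
      Module.finrank K (homology M y (i + 1) r) +
        Module.finrank K (LinearMap.ker ((smulMap M y i r).restrictScalars K)) := by
  refine finite_and_finrank_of_exact (μ := (smulMap M y (i + 1) r).restrictScalars K)
    (j := (inclusionMap M y (i + 1) (Nat.le_succ r)).restrictScalars K)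
    (q := (contractMap M y i r).restrictScalars K) ?_ ?_ ?_
  · ext x; exact SetLike.ext_iff.1 (ker_inclusionMap (M := M) y (i + 1) r) x
  · ext x; exact SetLike.ext_iff.1 (ker_contractMap (M := M) y i r) x
  · ext x; exact SetLike.ext_iff.1 (range_contractMap (M := M) y i r) x

theorem finite_and_finrank_ker_smulMap_zero (y : Fin n → R) (r : Fin n)
    [Module.Finite K (annihilatorModule M y r)] :
    Module.Finite K (LinearMap.ker ((smulMap M y 0 r).restrictScalars K)) ∧
    Module.finrank K (LinearMap.ker ((smulMap M y 0 r).restrictScalars K)) =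
      Module.finrank K (annihilatorModule M y r) :=
  have e : annihilatorModule M y r ≃ₗ[K] LinearMap.ker ((smulMap M y 0 r).restrictScalars K) :=
    (annihilatorModuleEquiv M y r).restrictScalars K
  ⟨Module.Finite.equiv e, e.finrank_eq.symm⟩

theorem finite_homology (y : Fin n → R)
    (hy : ∀ r, Module.Finite K (annihilatorModule M y r)) (i : ℕ) {p : ℕ} (hp : p ≤ n) :
    Module.Finite K (homology M y (i + 1) p) := by
  induction p generalizing i with
  | zero =>
    have := homology_subsingleton_zero (M := M) y i
    infer_instance
  | succ p ih =>
    have h1 : Module.Finite K (homology M y (i + 1) p) := ih i (by omega)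
    have h2 : Module.Finite K
        (LinearMap.ker ((smulMap M y i ⟨p, hp⟩).restrictScalars K)) := by
      cases i with
      | zero => exact (finite_and_finrank_ker_smulMap_zero K y ⟨p, hp⟩).1
      | succ i =>
        have := ih i (by omega)
        infer_instance
    exact (finite_and_finrank_homology_succ K y i ⟨p, hp⟩).1

theorem finrank_homology_one (y : Fin n → R)
    (hy : ∀ r, Module.Finite K (annihilatorModule M y r)) (r : Fin n) :
    Module.finrank K (homology M y 1 (r + 1)) + rankSMul K M y 1 r =
      Module.finrank K (homology M y 1 r) + Module.finrank K (annihilatorModule M y r) := by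
  have := finite_homology K y hy 0 r.2.le
  have h := finite_and_finrank_ker_smulMap_zero (M := M) K y r
  have := h.1
  rw [← h.2]
  exact (finite_and_finrank_homology_succ K y 0 r).2

/-- From degree two on, the homology at the right end is finite-dimensional, so rank-nullity trades
the kernel for a second rank. -/
theorem finrank_homology_add_two (y : Fin n → R)
    (hy : ∀ r, Module.Finite K (annihilatorModule M y r)) (i : ℕ) (r : Fin n) :
    Module.finrank K (homology M y (i + 2) (r + 1)) + rankSMul K M y (i + 2) r +
      rankSMul K M y (i + 1) r =
      Module.finrank K (homology M y (i + 2) r) + Module.finrank K (homology M y (i + 1) r) := by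
  have := finite_homology K y hy i r.2.le
  have := finite_homology K y hy (i + 1) r.2.le
  have h : Module.finrank K (homology M y (i + 2) (r + 1)) + rankSMul K M y (i + 2) r = _ :=
    (finite_and_finrank_homology_succ (M := M) K y (i + 1) r).2
  have h' := ((smulMap M y (i + 1) r).restrictScalars K).finrank_range_add_finrank_ker
  change rankSMul K M y (i + 1) r + _ = _ at h'
  change _ = Module.finrank K (homology M y (i + 2) r) + _ at h
  omega

theorem rankSMul_eq_zero_iff (y : Fin n → R)
    (hy : ∀ r, Module.Finite K (annihilatorModule M y r)) (i : ℕ) (r : Fin n) :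
    rankSMul K M y (i + 1) r = 0 ↔
      ∀ z ∈ cycles M y (i + 1) r, y r • z ∈ boundaries M y (i + 1) r := by
  have := finite_homology K y hy i r.2.le
  rw [rankSMul, ← smulMap_eq_zero_iff, Submodule.finrank_eq_zero, LinearMap.range_eq_bot]
  constructor
  · intro h
    ext x
    exact LinearMap.congr_fun h _
  · rintro h
    rw [h]; rfl

end Dimension

/-! ### Pascal's rule and the equality case of the bound -/

section Numerical

theorem sum_choose_one (α : ℕ → ℕ) (p : ℕ) :
    ∑ j ∈ Finset.range (p + 1), (p + 1 - (j + 1)).choose 0 * α j =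
      ∑ j ∈ Finset.range p, (p - (j + 1)).choose 0 * α j + α p := by
  simp [Finset.sum_range_succ]

theorem sum_choose_succ (α : ℕ → ℕ) (i p : ℕ) :
    ∑ j ∈ Finset.range (p + 1), (p + 1 - (j + 1)).choose (i + 1) * α j =
      ∑ j ∈ Finset.range p, (p - (j + 1)).choose (i + 1) * α j +
        ∑ j ∈ Finset.range p, (p - (j + 1)).choose i * α j := by
  rw [Finset.sum_range_succ, ← Finset.sum_add_distrib]
  simp only [Nat.sub_self, Nat.choose_zero_succ, zero_mul, add_zero]
  refine Finset.sum_congr rfl fun j hj => ?_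
  rw [Finset.mem_range] at hj
  rw [← add_mul, show p + 1 - (j + 1) = (p - (j + 1)) + 1 by omega, Nat.choose_succ_succ]
  ring

variable {n : ℕ} {h r b : ℕ → ℕ → ℕ} {α : ℕ → ℕ}

/-- Here `h i p` stands for dim H_{i+1}(p), `r` for the ranks and `b` for the binomial sums. Both
satisfy the same recursion except that `h` loses the nonnegative ranks. -/
theorem le_of_recursion (h0 : ∀ i, h i 0 = 0)
    (h1 : ∀ p < n, h 0 (p + 1) + r 0 p = h 0 p + α p)
    (h2 : ∀ i, ∀ p < n, h (i + 1) (p + 1) + r (i + 1) p + r i p = h (i + 1) p + h i p)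
    (b1 : ∀ p, b 0 (p + 1) = b 0 p + α p)
    (b2 : ∀ i p, b (i + 1) (p + 1) = b (i + 1) p + b i p) (i : ℕ) {p : ℕ} (hp : p ≤ n) :
    h i p ≤ b i p := by
  induction p generalizing i with
  | zero => simp [h0]
  | succ p ih =>
    cases i with
    | zero => have := h1 p hp; have := ih 0 (by omega); have := b1 p; omega
    | succ i =>
      have := h2 i p hp; have := ih i (by omega); have := ih (i + 1) (by omega)
      have := b2 i p; omega

theorem eq_of_recursion (h0 : ∀ i, h i 0 = 0)
    (h1 : ∀ p < n, h 0 (p + 1) + r 0 p = h 0 p + α p)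
    (h2 : ∀ i, ∀ p < n, h (i + 1) (p + 1) + r (i + 1) p + r i p = h (i + 1) p + h i p)
    (b1 : ∀ p, b 0 (p + 1) = b 0 p + α p)
    (b2 : ∀ i p, b (i + 1) (p + 1) = b (i + 1) p + b i p) (i : ℕ) (hn : h i n = b i n) :
    (∀ p ≤ n, h i p = b i p) ∧ ∀ p < n, r i p = 0 := by
  have key : ∀ k p, p + k = n → h i p = b i p := by
    intro k
    induction k with
    | zero => rintro p rfl; exact hn
    | succ k ih =>
      intro p hp
      have e := ih (p + 1) (by omega)
      have l := le_of_recursion h0 h1 h2 b1 b2 i (by omega : p ≤ n)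
      cases i with
      | zero => have := h1 p (by omega); have := b1 p; omega
      | succ i =>
        have := le_of_recursion h0 h1 h2 b1 b2 i (by omega : p ≤ n)
        have := h2 i p (by omega); have := b2 i p; omega
  refine ⟨fun p hp => key (n - p) p (by omega), fun p hp => ?_⟩
  have e := key (n - p) p (by omega)
  have e' := key (n - (p + 1)) (p + 1) (by omega)
  cases i with
  | zero => have := h1 p (by omega); have := b1 p; omega
  | succ i =>
    have := le_of_recursion h0 h1 h2 b1 b2 i (by omega : p ≤ n)
    have := h2 i p (by omega); have := b2 i p; omega

/-- Equality in the bound for one index propagates to the next one, as soon as the vanishing of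
the ranks does. -/
theorem eq_succ_of_recursion (h0 : ∀ i, h i 0 = 0) (b0 : ∀ i, b i 0 = 0)
    (h1 : ∀ p < n, h 0 (p + 1) + r 0 p = h 0 p + α p)
    (h2 : ∀ i, ∀ p < n, h (i + 1) (p + 1) + r (i + 1) p + r i p = h (i + 1) p + h i p)
    (b1 : ∀ p, b 0 (p + 1) = b 0 p + α p)
    (b2 : ∀ i p, b (i + 1) (p + 1) = b (i + 1) p + b i p) (i : ℕ)
    (hr : (∀ p < n, r i p = 0) → ∀ p < n, r (i + 1) p = 0) (hn : h i n = b i n) :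
    h (i + 1) n = b (i + 1) n := by
  obtain ⟨e, er⟩ := eq_of_recursion h0 h1 h2 b1 b2 i hn
  have er' := hr er
  have key : ∀ p ≤ n, h (i + 1) p = b (i + 1) p := by
    intro p hp
    induction p with
    | zero => rw [h0, b0]
    | succ p ih =>
      have := ih (by omega); have := h2 i p hp; have := b2 i p; have := e p (by omega)
      have := er p hp; have := er' p hp
      omega
  exact key n le_rfl

end Numerical

/-! ### Propagation of equality to higher homology -/

section Rigidity

variable (K : Type*) [Field K] {R : Type*} [CommRing R] [Algebra K R] {M : Type*} [AddCommGroup M]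
  [Module K M] [Module R M] [IsScalarTower K R M] {n : ℕ}

/-- Rigidity of the upper bound for the dimensions of Koszul homology. -/
theorem finrank_homology_eq_of_le (y : Fin n → R)
    (hy : ∀ r, Module.Finite K (annihilatorModule M y r)) {i k : ℕ} (hik : i ≤ k)
    (h : Module.finrank K (homology M y (i + 1) n) = ∑ j : Fin n,
      (n - (j + 1)).choose i * Module.finrank K (annihilatorModule M y j)) :
    Module.finrank K (homology M y (k + 1) n) = ∑ j : Fin n,
      (n - (j + 1)).choose k * Module.finrank K (annihilatorModule M y j) := by
  induction k, hik using Nat.le_induction with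
  | base => exact h
  | succ k _ ih =>
    let α : ℕ → ℕ := fun p =>
      if hp : p < n then Module.finrank K (annihilatorModule M y ⟨p, hp⟩) else 0
    let r : ℕ → ℕ → ℕ := fun i p => if hp : p < n then rankSMul K M y (i + 1) ⟨p, hp⟩ else 0
    have hα (j : Fin n) : Module.finrank K (annihilatorModule M y j) = α j := by simp [α]
    have hs (i : ℕ) : ∑ j : Fin n, (n - (j + 1)).choose i * α j =
        ∑ j ∈ Finset.range n, (n - (j + 1)).choose i * α j :=
      Fin.sum_univ_eq_sum_range (fun j => (n - (j + 1)).choose i * α j) n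
    simp only [hα, hs] at ih ⊢
    refine eq_succ_of_recursion (h := fun i p => Module.finrank K (homology M y (i + 1) p))
      (b := fun i p => ∑ j ∈ Finset.range p, (p - (j + 1)).choose i * α j) (α := α) (r := r)
      ?_ ?_ ?_ ?_ ?_ ?_ k ?_ ih
    · intro i
      have := homology_subsingleton_zero (M := M) y i
      exact Module.finrank_zero_of_subsingleton
    · simp
    · intro p hp
      simpa [α, r, hp] using finrank_homology_one K y hy ⟨p, hp⟩
    · intro i p hp
      simpa [r, hp] using finrank_homology_add_two K y hy i ⟨p, hp⟩
    · exact fun p => sum_choose_one α p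
    · exact fun i p => sum_choose_succ α i p
    · intro h p hp
      -- Vanishing ranks mean that each form kills the homology of its predecessors, which is the
      -- input of the rigidity lemma.
      have h' : ∀ q : Fin n, ∀ z ∈ cycles M y (k + 1) q, y q • z ∈ boundaries M y (k + 1) q := by
        intro q
        rw [← rankSMul_eq_zero_iff K y hy]
        simpa [r] using h q q.2
      simp only [r, hp, dif_pos]
      rw [rankSMul_eq_zero_iff K y hy]
      exact fun z hz => smul_mem_boundaries_succ h' _ hz

end Rigidity

/-! ### Acyclicity for regular sequences -/

section Acyclic

variable {R : Type*} [CommRing R] {M : Type*} [AddCommGroup M] [Module R M] {n : ℕ}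

/-- In the exact sequence both neighbours vanish: the left one by induction, the right one because
the annihilator module is zero (degree one) or by induction. -/
theorem homology_subsingleton (y : Fin n → R)
    (hy : ∀ r, colonSubmodule M y r ≤ initialSubmodule M y r) (i : ℕ) {p : ℕ} (hp : p ≤ n) :
    Subsingleton (homology M y (i + 1) p) := by
  induction p generalizing i with
  | zero => exact homology_subsingleton_zero y i
  | succ p ih =>
    set r : Fin n := ⟨p, hp⟩
    have h1 : Subsingleton (homology M y (i + 1) r) := ih i (by omega)
    have h2 : Subsingleton (LinearMap.ker (smulMap M y i r)) := by
      cases i with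
      | zero =>
        have : Subsingleton (annihilatorModule M y r) :=
          Submodule.Quotient.subsingleton_iff.2 (Submodule.submoduleOf_eq_top.2 (hy r))
        exact (annihilatorModuleEquiv M y r).symm.subsingleton
      | succ i =>
        have : Subsingleton (homology M y (i + 1) r) := ih i (by omega)
        infer_instance
    refine subsingleton_of_forall_eq 0 fun x => ?_
    have h3 : contractMap M y i r x = 0 := by
      have h4 : contractMap M y i r x ∈ LinearMap.ker (smulMap M y i r) := by
        rw [← range_contractMap]; exact ⟨x, rfl⟩
      exact congrArg Subtype.val (Subsingleton.elim (⟨_, h4⟩ : LinearMap.ker (smulMap M y i r)) 0)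
    have h5 : x ∈ LinearMap.range (inclusionMap M y (i + 1) (Nat.le_succ r)) := by
      rw [← ker_contractMap]; exact h3
    obtain ⟨z, rfl⟩ := h5
    rw [Subsingleton.elim z 0, map_zero]

theorem cycles_le_boundaries (y : Fin n → R)
    (hy : ∀ r, colonSubmodule M y r ≤ initialSubmodule M y r) (i : ℕ) {p : ℕ} (hp : p ≤ n) :
    cycles M y (i + 1) p ≤ boundaries M y (i + 1) p := by
  have := homology_subsingleton y hy i hp
  exact fun z hz => mkQ_eq_zero.1
    (Subsingleton.elim (Submodule.Quotient.mk ⟨z, hz⟩ : homology M y (i + 1) p) 0)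

end Acyclic

/-! ### Invertible coefficient matrices as changes of coordinates -/

section LinearForms

variable {K : Type u} [Field K] {n : ℕ}

theorem linearForms_one : linearForms (fun x : Fin n × Fin n => (1 : Matrix (Fin n) (Fin n) K) x.1 x.2)
    = MvPolynomial.X := by
  ext1 p
  simp [linearForms, Matrix.one_apply]

theorem aeval_linearForms (c c' : Fin n × Fin n → K) (p : Fin n) :
    MvPolynomial.aeval (linearForms c) (linearForms c' p) =
      linearForms (fun x => (Matrix.of (Function.curry c') * Matrix.of (Function.curry c)) x.1 x.2)
        p := by
  simp only [linearForms, map_sum, map_mul, MvPolynomial.aeval_X, MvPolynomial.algHom_C,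
    MvPolynomial.algebraMap_eq, Matrix.mul_apply, Matrix.of_apply, Function.curry_apply,
    Finset.mul_sum, Finset.sum_mul]
  rw [Finset.sum_comm]
  simp only [mul_assoc]

/-- A coefficient matrix with nonzero determinant gives a linear change of coordinates. -/
theorem exists_algEquiv_X_eq_linearForms {c : Fin n × Fin n → K}
    (hc : (Matrix.of (Function.curry c)).det ≠ 0) :
    ∃ e : MvPolynomial (Fin n) K ≃ₐ[K] MvPolynomial (Fin n) K,
      ∀ p, e (MvPolynomial.X p) = linearForms c p := by
  set C : Matrix (Fin n) (Fin n) K := Matrix.of (Function.curry c)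
  have hu : IsUnit C.det := isUnit_iff_ne_zero.2 hc
  let c' : Fin n × Fin n → K := fun x => C⁻¹ x.1 x.2
  have hc' : Matrix.of (Function.curry c') = C⁻¹ := rfl
  refine ⟨AlgEquiv.ofAlgHom (MvPolynomial.aeval (linearForms c))
    (MvPolynomial.aeval (linearForms c')) ?_ ?_, fun p => by simp⟩
  · ext1 p
    simp only [AlgHom.comp_apply, MvPolynomial.aeval_X, aeval_linearForms, AlgHom.id_apply, hc']
    change linearForms (fun x => (C⁻¹ * C) x.1 x.2) p = _
    rw [Matrix.nonsing_inv_mul _ hu, linearForms_one]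
  · ext1 p
    simp only [AlgHom.comp_apply, MvPolynomial.aeval_X, aeval_linearForms, AlgHom.id_apply, hc']
    change linearForms (fun x => (C * C⁻¹) x.1 x.2) p = _
    rw [Matrix.mul_nonsing_inv _ hu, linearForms_one]

/-- Membership in an ideal of variables is tested monomial by monomial, and a variable dividing x_p
m other than x_p divides m. -/
theorem mem_span_X_of_X_mul_mem {σ : Type*} {s : Set σ} {p : σ} (hp : p ∉ s)
    {f : MvPolynomial σ K}
    (hf : MvPolynomial.X p * f ∈ Ideal.span (MvPolynomial.X '' s : Set (MvPolynomial σ K))) :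
    f ∈ Ideal.span (MvPolynomial.X '' s : Set (MvPolynomial σ K)) := by
  rw [MvPolynomial.mem_ideal_span_X_image] at hf ⊢
  intro m hm
  obtain ⟨i, hi, h⟩ := hf (Finsupp.single p 1 + m) (by
    rw [MvPolynomial.mem_support_iff, MvPolynomial.coeff_X_mul]
    exact MvPolynomial.mem_support_iff.1 hm)
  refine ⟨i, hi, ?_⟩
  have : p ≠ i := fun h => hp (h ▸ hi)
  simpa [Finsupp.single_apply, this] using h

/-- Being a regular sequence is invariant under automorphisms, so the change of coordinates reduces
to the variables themselves. -/
theorem colonSubmodule_linearForms_le {c : Fin n × Fin n → K}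
    (hc : (Matrix.of (Function.curry c)).det ≠ 0) (p : Fin n) :
    colonSubmodule (MvPolynomial (Fin n) K) (linearForms c) p ≤
      initialSubmodule (MvPolynomial (Fin n) K) (linearForms c) p := by
  obtain ⟨e, he⟩ := exists_algEquiv_X_eq_linearForms hc
  have h1 : initialSubmodule (MvPolynomial (Fin n) K) (linearForms c) p =
      (Ideal.span (MvPolynomial.X '' {q | q < p} : Set (MvPolynomial (Fin n) K))).map e := by
    have : linearForms c = e ∘ MvPolynomial.X := by ext1 q; simp [he]
    rw [initialSubmodule, smul_eq_mul, Ideal.mul_top, Ideal.map_span, this, Set.image_comp]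
  have h2 (f : MvPolynomial (Fin n) K) :
      f ∈ initialSubmodule (MvPolynomial (Fin n) K) (linearForms c) p ↔
      e.symm f ∈ Ideal.span (MvPolynomial.X '' {q | q < p} : Set (MvPolynomial (Fin n) K)) := by
    rw [h1]
    constructor
    · intro h
      rw [Ideal.mem_map_iff_of_surjective e e.surjective] at h
      obtain ⟨g, hg, rfl⟩ := h
      simpa using hg
    · intro h
      simpa using Ideal.mem_map_of_mem e h
  intro f hf
  have hf' : linearForms c p * f ∈
      initialSubmodule (MvPolynomial (Fin n) K) (linearForms c) p := hf
  rw [h2] at hf' ⊢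
  refine mem_span_X_of_X_mul_mem (p := p) (by simp) ?_
  rwa [map_mul, ← he, AlgEquiv.symm_apply_apply] at hf'

theorem span_range_linearForms {c : Fin n × Fin n → K}
    (hc : (Matrix.of (Function.curry c)).det ≠ 0) :
    Ideal.span (Set.range (linearForms c)) = gradedMaximalIdeal K n := by
  apply le_antisymm
  · rw [Ideal.span_le]
    rintro _ ⟨p, rfl⟩
    exact Ideal.sum_mem _ fun q _ => Ideal.mul_mem_left _ _ (Ideal.subset_span ⟨q, rfl⟩)
  · rw [gradedMaximalIdeal, Ideal.span_le]
    rintro _ ⟨p, rfl⟩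
    set C : Matrix (Fin n) (Fin n) K := Matrix.of (Function.curry c)
    have hu : IsUnit C.det := isUnit_iff_ne_zero.2 hc
    have h := aeval_linearForms c (fun x => C⁻¹ x.1 x.2) p
    change _ = linearForms (fun x => (C⁻¹ * C) x.1 x.2) p at h
    rw [Matrix.nonsing_inv_mul _ hu, linearForms_one] at h
    rw [← h, linearForms]
    simp only [map_sum, map_mul, MvPolynomial.aeval_X]
    exact Ideal.sum_mem _ fun q _ => Ideal.mul_mem_left _ _ (Ideal.subset_span ⟨q, rfl⟩)

end LinearForms

/-! ### Koszul chains of a fixed degree as finite free modules -/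

section Cells

variable {R : Type*} [CommRing R] (M : Type*) [AddCommGroup M] [Module R M] (n : ℕ)

/-- Families of elements of `M` indexed by the sets of `i` basis vectors. -/
abbrev Cells (i : ℕ) : Type _ := {A : Finset (Fin n) // A.card = i} → M

variable (R) in
/-- The form with given coefficients in degree `i` and zero coefficients in other degrees. -/
def ofCells (i : ℕ) : Cells M n i →ₗ[R] (Finset (Fin n) → M) where
  toFun f A := if h : A.card = i then f ⟨A, h⟩ else 0
  map_add' f g := by ext A; simp only [Pi.add_apply]; split_ifs <;> simp
  map_smul' a f := by ext A; simp only [Pi.smul_apply, RingHom.id_apply]; split_ifs <;> simp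

variable (R) in
/-- The coefficients in degree `i` of a form. -/
def toCells (i : ℕ) : (Finset (Fin n) → M) →ₗ[R] Cells M n i :=
  LinearMap.funLeft R M Subtype.val

variable {M n}

theorem toCells_ofCells {i : ℕ} (f : Cells M n i) : toCells R M n i (ofCells R M n i f) = f := by
  ext ⟨A, hA⟩
  simp [toCells, ofCells, LinearMap.funLeft_apply, hA]

theorem ofCells_mem {i : ℕ} (f : Cells M n i) : ofCells R M n i f ∈ forms R M n i n := by
  intro A hA
  refine ⟨?_, fun a _ => a.2⟩
  by_contra h
  exact hA (dif_neg h)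

theorem ofCells_toCells {i p : ℕ} {f : Finset (Fin n) → M} (hf : f ∈ forms R M n i p) :
    ofCells R M n i (toCells R M n i f) = f := by
  ext A
  change (if h : A.card = i then f A else 0) = f A
  split_ifs with h
  · rfl
  · by_contra h'
    exact h (hf A (Ne.symm h')).1

variable (M) in
/-- The Koszul differential in terms of coefficients. -/
def cellDifferential (y : Fin n → R) (i : ℕ) : Cells M n (i + 1) →ₗ[R] Cells M n i :=
  toCells R M n i ∘ₗ differential y ∘ₗ ofCells R M n (i + 1)

theorem ofCells_cellDifferential (y : Fin n → R) (i : ℕ) (f : Cells M n (i + 1)) :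
    ofCells R M n i (cellDifferential M y i f) = differential y (ofCells R M n (i + 1) f) :=
  ofCells_toCells (differential_mem y (ofCells_mem f))

theorem cellDifferential_comp (y : Fin n → R) (i : ℕ) :
    cellDifferential M y i ∘ₗ cellDifferential M y (i + 1) = 0 := by
  refine LinearMap.ext fun f => ?_
  rw [LinearMap.comp_apply, cellDifferential, LinearMap.comp_apply, LinearMap.comp_apply, ofCells_cellDifferential,
    differential_differential, map_zero]
  rfl

theorem cellDifferential_eq_zero_iff (y : Fin n → R) (i : ℕ) (f : Cells M n (i + 1)) :
    cellDifferential M y i f = 0 ↔ ofCells R M n (i + 1) f ∈ cycles M y (i + 1) n := by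
  rw [mem_cycles, ← ofCells_cellDifferential]
  constructor
  · intro h; exact ⟨ofCells_mem f, by rw [h, map_zero]⟩
  · intro h; rw [← toCells_ofCells (R := R) (cellDifferential M y i f), h.2, map_zero]

theorem mem_range_cellDifferential_iff (y : Fin n → R) (i : ℕ) (f : Cells M n i) :
    f ∈ LinearMap.range (cellDifferential M y i) ↔
      ofCells R M n i f ∈ boundaries M y i n := by
  constructor
  · rintro ⟨g, rfl⟩
    rw [ofCells_cellDifferential]
    exact ⟨_, ofCells_mem g, rfl⟩
  · rintro ⟨g, hg, h⟩
    refine ⟨toCells R M n (i + 1) g, ?_⟩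
    rw [cellDifferential, LinearMap.comp_apply, LinearMap.comp_apply, ofCells_toCells hg, h,
      toCells_ofCells]

/-- On pure tensors this says that the M-valued Koszul complex is the one over R tensored with M. -/
theorem cellDifferential_smul (y : Fin n → R) (i : ℕ) (f : Cells R n (i + 1)) (m : M) :
    cellDifferential M y i (fun A => f A • m) = fun A => cellDifferential R y i f A • m := by
  have h1 : ofCells R M n (i + 1) (fun A => f A • m) =
      fun A => ofCells R R n (i + 1) f A • m := by
    ext A
    simp only [ofCells, LinearMap.coe_mk, AddHom.coe_mk]
    split_ifs <;> simp
  ext A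
  simp only [cellDifferential, LinearMap.comp_apply, toCells, LinearMap.funLeft_apply, h1,
    differential_apply, Finset.sum_apply, Finset.sum_smul, Pi.smul_apply, contract_apply]
  refine Finset.sum_congr rfl fun r _ => ?_
  split_ifs
  · simp
  · rw [smul_assoc, smul_assoc]

/-- The homology of the complex of coefficients. -/
noncomputable def cellHomologyEquiv (y : Fin n → R) (i : ℕ) {S : Submodule R (LinearMap.ker (cellDifferential M y i))}
    (hS : ∀ x, x ∈ S ↔ (x : Cells M n (i + 1)) ∈ LinearMap.range (cellDifferential M y (i + 1))) :
    (LinearMap.ker (cellDifferential M y i) ⧸ S) ≃ₗ[R] homology M y (i + 1) n := by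
  let e : LinearMap.ker (cellDifferential M y i) ≃ₗ[R] cycles M y (i + 1) n :=
    { toFun := fun f => ⟨ofCells R M n (i + 1) f, (cellDifferential_eq_zero_iff y i _).1 f.2⟩
      map_add' := fun f g => by ext1; simp
      map_smul' := fun a f => by ext1; simp
      invFun := fun z => ⟨toCells R M n (i + 1) z, by
        rw [LinearMap.mem_ker, cellDifferential_eq_zero_iff (R := R), ofCells_toCells z.2.1]
        exact z.2⟩
      left_inv := fun f => by ext1; exact toCells_ofCells _
      right_inv := fun z => by ext1; exact ofCells_toCells z.2.1 }
  refine Submodule.Quotient.equiv _ _ e ?_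
  ext z
  constructor
  · rintro ⟨f, hf, rfl⟩
    exact (mem_range_cellDifferential_iff y (i + 1) _).1 ((hS f).1 hf)
  · intro hz
    refine ⟨e.symm z, (hS _).2 ((mem_range_cellDifferential_iff y (i + 1) _).2 ?_), by simp⟩
    change ofCells R M n (i + 1) (toCells R M n (i + 1) z) ∈ _
    rw [ofCells_toCells z.2.1]
    exact hz

end Cells

/-! ### The Koszul resolution and Tor -/

section Tor

open MonoidalCategory

variable {R : Type u} [CommRing R] {n : ℕ}

/-- The Koszul complex of a sequence `y` in `R`. -/
noncomputable def complex (y : Fin n → R) : ChainComplex (ModuleCat.{u} R) ℕ :=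
  ChainComplex.of (fun i => ModuleCat.of R (Cells R n i))
    (fun i => ModuleCat.ofHom (cellDifferential R y i)) fun i => by
      rw [← ModuleCat.ofHom_comp, cellDifferential_comp]; rfl

theorem complex_d (y : Fin n → R) (i : ℕ) :
    (complex y).d (i + 1) i = ModuleCat.ofHom (cellDifferential R y i) := by
  simp [complex]

/-- The augmentation of the Koszul complex. -/
noncomputable def augmentation (n : ℕ) (I : Ideal R) : Cells R n 0 →ₗ[R] R ⧸ I :=
  I.mkQ ∘ₗ LinearMap.proj ⟨∅, Finset.card_empty⟩

theorem differential_apply_empty (y : Fin n → R) (f : Finset (Fin n) → R) :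
    differential y f ∅ = ∑ r, y r * f {r} := by
  simp [differential_apply, contract_apply, sign]

theorem range_cellDifferential_zero (y : Fin n → R) {I : Ideal R}
    (hI : Ideal.span (Set.range y) = I) :
    LinearMap.range (cellDifferential R y 0) = LinearMap.ker (augmentation n I) := by
  ext f
  rw [mem_range_cellDifferential_iff, LinearMap.mem_ker, augmentation, LinearMap.comp_apply,
    Submodule.mkQ_apply, Submodule.Quotient.mk_eq_zero, LinearMap.proj_apply]
  have h0 : f ⟨∅, Finset.card_empty⟩ = ofCells R R n 0 f ∅ := by simp [ofCells]
  rw [h0, ← hI, Ideal.mem_span_range_iff_exists_fun]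
  constructor
  · rintro ⟨g, -, hg⟩
    refine ⟨fun r => g {r}, ?_⟩
    rw [← hg, differential_apply_empty]
    exact Finset.sum_congr rfl fun r _ => mul_comm _ _
  · rintro ⟨a, ha⟩
    let g : Finset (Fin n) → R := ∑ r, a r • Pi.single {r} (1 : R)
    have hg (r : Fin n) : g {r} = a r := by
      simp [g, Finset.sum_apply, Pi.single_apply, Finset.singleton_inj]
    have hgm : g ∈ forms R R n 1 n := by
      refine Submodule.sum_mem _ fun r _ => Submodule.smul_mem _ _ ?_
      intro A hA
      have : A = {r} := by
        by_contra h
        exact hA (Pi.single_eq_of_ne h _)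
      subst this
      simp
    refine ⟨g, hgm, ?_⟩
    rw [eq_constLinearMap (differential_mem y hgm), eq_constLinearMap (ofCells_mem f),
      differential_apply_empty, ← ha]
    simp only [hg, mul_comm]

/-- The augmentation as a morphism from the Koszul complex. -/
noncomputable def augmentationHom (y : Fin n → R) (I : Ideal R) :
    (complex y).X 0 ⟶ ModuleCat.of R (R ⧸ I) :=
  ModuleCat.ofHom (augmentation n I)

theorem complex_d_comp_augmentationHom (y : Fin n → R) {I : Ideal R}
    (hI : Ideal.span (Set.range y) = I) : (complex y).d 1 0 ≫ augmentationHom y I = 0 := by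
  rw [complex_d]
  ext1
  refine LinearMap.ext fun f => ?_
  have : cellDifferential R y 0 f ∈ LinearMap.ker (augmentation n I) := by
    rw [← range_cellDifferential_zero y hI]; exact ⟨f, rfl⟩
  exact this

/-- The Koszul complex of a sequence for which all colon submodules are trivial is a projective
resolution. -/
noncomputable def resolution (y : Fin n → R) (hy : ∀ r, colonSubmodule R y r ≤ initialSubmodule R y r)
    {I : Ideal R} (hI : Ideal.span (Set.range y) = I) :
    ProjectiveResolution (ModuleCat.of R (R ⧸ I)) where
  complex := complex y
  projective i := by
    change Projective (ModuleCat.of R (Cells R n i))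
    infer_instance
  π := (ChainComplex.toSingle₀Equiv _ _).symm ⟨augmentationHom y I, complex_d_comp_augmentationHom y hI⟩
  quasiIso := ⟨fun i => by
    cases i with
    | zero =>
      rw [ChainComplex.quasiIsoAt₀_iff, ShortComplex.quasiIso_iff_of_zeros']
      · rw [ShortComplex.moduleCat_exact_iff, ModuleCat.epi_iff_surjective]
        constructor
        · intro f hf
          change ((ChainComplex.toSingle₀Equiv (complex y) _).symm
             ⟨augmentationHom y I, complex_d_comp_augmentationHom y hI⟩).f 0 f = 0 at hf
          rw [ChainComplex.toSingle₀Equiv_symm_apply_f_zero] at hf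
          change ∃ g, (complex y).d 1 0 g = f
          rw [complex_d]
          change f ∈ LinearMap.range (cellDifferential R y 0)
          rw [range_cellDifferential_zero y hI]
          exact hf
        · change Function.Surjective (((ChainComplex.toSingle₀Equiv (complex y) _).symm
            ⟨augmentationHom y I, complex_d_comp_augmentationHom y hI⟩).f 0)
          rw [ChainComplex.toSingle₀Equiv_symm_apply_f_zero]
          exact (Submodule.mkQ_surjective I).comp fun a => ⟨fun _ => a, rfl⟩
      · exact (complex y).shape _ _ (by simp)
      · rfl
      · rfl
    | succ i =>
      rw [quasiIsoAt_iff_exactAt']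
      · rw [HomologicalComplex.exactAt_iff' _ (i + 1 + 1) (i + 1) i (by simp) (by simp),
          ShortComplex.moduleCat_exact_iff]
        intro f hf
        change (complex y).d (i + 1) i f = 0 at hf
        change ∃ g, (complex y).d (i + 1 + 1) (i + 1) g = f
        rw [complex_d] at hf ⊢
        have h1 := (cellDifferential_eq_zero_iff y i f).1 hf
        exact (mem_range_cellDifferential_iff y (i + 1) f).2
          (cycles_le_boundaries y hy i le_rfl h1)
      · apply ChainComplex.exactAt_succ_single_obj⟩

variable {M : Type u} [AddCommGroup M] [Module R M]

/-- Families of elements of `M` as a tensor product. -/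
noncomputable def cellsTensorEquiv (M : Type u) [AddCommGroup M] [Module R M] (n i : ℕ) :
    TensorProduct R (Cells R n i) M ≃ₗ[R] Cells M n i :=
  (TensorProduct.comm R _ _).trans (TensorProduct.piScalarRight R R M _)

theorem cellsTensorEquiv_tmul (i : ℕ) (f : Cells R n i) (m : M) :
    cellsTensorEquiv M n i (f ⊗ₜ[R] m) = fun A => f A • m := by
  simp [cellsTensorEquiv]

theorem cellDifferential_cellsTensorEquiv (y : Fin n → R) (i : ℕ) :
    cellDifferential M y i ∘ₗ (cellsTensorEquiv M n (i + 1)).toLinearMap =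
      (cellsTensorEquiv M n i).toLinearMap ∘ₗ (cellDifferential R y i).rTensor M := by
  refine TensorProduct.ext' fun f m => ?_
  simp only [LinearMap.comp_apply, LinearEquiv.coe_coe, LinearMap.rTensor_tmul,
    cellsTensorEquiv_tmul, cellDifferential_smul]

/-- The complex of coefficients at one place. -/
noncomputable def cellShortComplex (M : Type u) [AddCommGroup M] [Module R M] (y : Fin n → R)
    (i : ℕ) : ShortComplex (ModuleCat.{u} R) :=
  ShortComplex.moduleCatMk (cellDifferential M y (i + 1)) (cellDifferential M y i)
    (cellDifferential_comp y i)

/-- `Tor` of `R ⧸ (y)` is Koszul homology. -/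
theorem nonempty_torEquiv (M : Type u) [AddCommGroup M] [Module R M] (y : Fin n → R)
    (hy : ∀ r, colonSubmodule R y r ≤ initialSubmodule R y r)
    {I : Ideal R} (hI : Ideal.span (Set.range y) = I) (i : ℕ) :
    Nonempty ((((Tor' (ModuleCat.{u} R) (i + 1)).obj (ModuleCat.of R (R ⧸ I))).obj
      (ModuleCat.of R M)) ≃ₗ[R] homology M y (i + 1) n) := by
  let F := (tensoringRight (ModuleCat.{u} R)).obj (ModuleCat.of R M)
  let P := resolution y hy hI
  let C := (F.mapHomologicalComplex (ComplexShape.down ℕ)).obj P.complex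
  -- `Tor'` derives the first argument, so the Koszul resolution of R ⧸ I can be used directly, with
  -- no symmetry of Tor.
  have e1 : ((Tor' (ModuleCat.{u} R) (i + 1)).obj (ModuleCat.of R (R ⧸ I))).obj
      (ModuleCat.of R M) ≅ (C.sc (i + 1)).homology := P.isoLeftDerivedObj F (i + 1)
  have e2 : (C.sc (i + 1)).homology ≅ (C.sc' (i + 1 + 1) (i + 1) i).homology :=
    ShortComplex.homologyMapIso (C.isoSc' (i + 1 + 1) (i + 1) i (by simp) (by simp))
  let t (j : ℕ) : C.X j ≅ ModuleCat.of R (Cells M n j) :=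
    (cellsTensorEquiv (R := R) M n j).toModuleIso
  have ht (j : ℕ) : (t (j + 1)).hom ≫ ModuleCat.ofHom (cellDifferential M y j) =
      C.d (j + 1) j ≫ (t j).hom := by
    ext1
    change _ = (t j).hom.hom ∘ₗ (((complex y).d (j + 1) j) ▷ (ModuleCat.of R M)).hom
    rw [complex_d]
    exact cellDifferential_cellsTensorEquiv y j
  have e3 : (C.sc' (i + 1 + 1) (i + 1) i).homology ≅ (cellShortComplex M y i).homology :=
    ShortComplex.homologyMapIso (ShortComplex.isoMk (t _) (t _) (t _) (ht _) (ht _))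
  have e4 := (cellShortComplex M y i).moduleCatHomologyIso
  refine ⟨(e1 ≪≫ e2 ≪≫ e3 ≪≫ e4).toLinearEquiv.trans (cellHomologyEquiv y i ?_)⟩
  intro x
  constructor
  · rintro ⟨g, rfl⟩; exact ⟨g, rfl⟩
  · rintro ⟨g, hg⟩; exact ⟨g, Subtype.ext hg⟩

end Tor

/-! ### Betti numbers as Koszul homology dimensions -/

section Betti

theorem bettiNumber_eq_finrank_homology {K : Type u} [Field K] {n : ℕ}
    (M : Type u) [AddCommGroup M] [Module K M] [Module (MvPolynomial (Fin n) K) M]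
    [IsScalarTower K (MvPolynomial (Fin n) K) M] {c : Fin n × Fin n → K}
    (hc : (Matrix.of (Function.curry c)).det ≠ 0) (i : ℕ) :
    bettiNumber K n M (i + 1) = Module.finrank K (homology M (linearForms c) (i + 1) n) := by
  obtain ⟨e⟩ := nonempty_torEquiv M (linearForms c) (colonSubmodule_linearForms_le hc)
    (span_range_linearForms hc) i
  rw [bettiNumber]
  -- The isomorphism is linear over the polynomial ring; the K-structure on Tor is restriction along
  -- `C`, matched with the one on homology through the scalar tower.
  refine LinearEquiv.finrank_eq (R := K)
    { toFun := e, invFun := e.symm, map_add' := e.map_add, left_inv := e.left_inv,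
      right_inv := e.right_inv, map_smul' := fun a x => ?_ }
  refine (e.map_smul (MvPolynomial.C a) x).trans ?_
  rw [← MvPolynomial.algebraMap_eq, algebraMap_smul]
  rfl

end Betti

end Koszul

/-! ### Generic freeness over a Noetherian domain -/

section GenericFreeness

/-- A module over a domain `B` is generically free if, up to powers of some nonzero `g`, it is
spanned by a linearly independent set. -/
def GenericallyFree (B : Type*) [CommRing B] (Q : Type*) [AddCommGroup Q] [Module B Q] : Prop :=
  ∃ g : B, g ≠ 0 ∧ ∃ s : Set Q, LinearIndepOn B id s ∧
    ∀ q : Q, ∃ k : ℕ, g ^ k • q ∈ Submodule.span B s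

/-- All finitely generated modules over the `B`-algebra `A` are generically free over `B`. -/
def FiniteModulesGenericallyFree (B : Type*) [CommRing B] (A : Type*) [CommRing A] [Algebra B A] :
    Prop :=
  ∀ (Q : Type u) [AddCommGroup Q] [Module A Q] [Module B Q] [IsScalarTower B A Q]
    [Module.Finite A Q], GenericallyFree B Q

variable {B : Type*} [CommRing B]

/-- Take a maximal independent set among finitely many generators; each generator has a nonzero
multiple in its span, and the product of these multipliers serves all. -/
theorem GenericallyFree.of_finite [IsDomain B] {Q : Type*} [AddCommGroup Q] [Module B Q] [Module.Finite B Q] :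
    GenericallyFree B Q := by
  obtain ⟨n, v, hv⟩ := Module.Finite.exists_fin (R := B) (M := Q)
  obtain ⟨s, hs, h⟩ := exists_maximal_linearIndepOn B v
  have h' : ∀ i, ∃ a : B, a ≠ 0 ∧ a • v i ∈ Submodule.span B (v '' s) := by
    intro i
    by_cases hi : i ∈ s
    · exact ⟨1, one_ne_zero, by rw [one_smul]; exact Submodule.subset_span ⟨i, hi, rfl⟩⟩
    · exact h i hi
  choose a ha hav using h'
  refine ⟨∏ i, a i, Finset.prod_ne_zero_iff.2 fun i _ => ha i, v '' s, hs.id_image, fun q => ⟨1, ?_⟩⟩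
  rw [pow_one]
  have hq : q ∈ Submodule.span B (Set.range v) := by rw [hv]; trivial
  induction hq using Submodule.span_induction with
  | mem q hq =>
    obtain ⟨i, rfl⟩ := hq
    rw [← Finset.prod_erase_mul _ _ (Finset.mem_univ i), mul_smul]
    exact Submodule.smul_mem _ _ (hav i)
  | zero => simp
  | add q q' _ _ h1 h2 => rw [smul_add]; exact add_mem h1 h2
  | smul b q _ h1 => rw [smul_comm]; exact Submodule.smul_mem _ _ h1

theorem FiniteModulesGenericallyFree.of_surjective {A A' : Type*} [CommRing A] [Algebra B A]
    [CommRing A'] [Algebra B A'] (f : A →ₐ[B] A') (hf : Function.Surjective f)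
    (h : FiniteModulesGenericallyFree.{u} B A) : FiniteModulesGenericallyFree.{u} B A' := by
  intro Q _ _ _ _ _
  let _ : Module A Q := Module.compHom Q f.toRingHom
  have hsmul (a : A) (q : Q) : a • q = f a • q := rfl
  have : IsScalarTower B A Q := ⟨fun b a q => by rw [hsmul, hsmul, map_smul, smul_assoc]⟩
  have : Module.Finite A Q := by
    obtain ⟨s, hs⟩ := (Module.Finite.fg_top : (⊤ : Submodule A' Q).FG)
    refine ⟨⟨s, eq_top_iff.2 fun q _ => ?_⟩⟩
    have hq : q ∈ Submodule.span A' (s : Set Q) := by rw [hs]; trivial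
    induction hq using Submodule.span_induction with
    | mem q hq => exact Submodule.subset_span hq
    | zero => exact zero_mem _
    | add q q' _ _ h1 h2 => exact add_mem (h1 trivial) (h2 trivial)
    | smul a q _ h1 =>
      obtain ⟨a, rfl⟩ := hf a
      exact Submodule.smul_mem _ a (h1 trivial)
  exact h Q

section Filtration

variable {A : Type*} [CommRing A] {Q : Type*} [AddCommGroup Q] [Module A Q]
  (φ : Q →ₗ[A] Q) (Q₀ : Submodule A Q)

/-- The submodule `∑_{j < k} φ^j(Q₀)`. -/
def powFiltration : ℕ → Submodule A Q
  | 0 => ⊥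
  | k + 1 => powFiltration k ⊔ Q₀.map (φ ^ k)

theorem powFiltration_mono : Monotone (powFiltration φ Q₀) :=
  monotone_nat_of_le_succ fun _ => le_sup_left

theorem map_powFiltration_le (k : ℕ) :
    (powFiltration φ Q₀ k).map φ ≤ powFiltration φ Q₀ (k + 1) := by
  induction k with
  | zero => simp [powFiltration]
  | succ k ih =>
    rw [powFiltration, Submodule.map_sup]
    refine sup_le (ih.trans (powFiltration_mono φ Q₀ (Nat.le_succ _))) ?_
    rw [← Submodule.map_comp, powFiltration, ← Module.End.mul_eq_comp, ← pow_succ']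
    exact le_sup_right

theorem pow_mem_powFiltration {k l : ℕ} (hkl : k < l) {q : Q} (hq : q ∈ Q₀) :
    (φ ^ k) q ∈ powFiltration φ Q₀ l :=
  powFiltration_mono φ Q₀ hkl (Submodule.mem_sup_right ⟨q, hq, rfl⟩)

/-- The kernel of the surjection from `Q₀` to the `k`-th graded piece of the filtration. -/
def filtrationKernel (k : ℕ) : Submodule A Q₀ :=
  (powFiltration φ Q₀ k).comap ((φ ^ k) ∘ₗ Q₀.subtype)

theorem mem_filtrationKernel {k : ℕ} {q : Q₀} :
    q ∈ filtrationKernel φ Q₀ k ↔ (φ ^ k) q ∈ powFiltration φ Q₀ k := Iff.rfl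

theorem filtrationKernel_mono : Monotone (filtrationKernel φ Q₀) := by
  refine monotone_nat_of_le_succ fun k q hq => ?_
  rw [mem_filtrationKernel, pow_succ']
  exact map_powFiltration_le φ Q₀ k ⟨_, hq, rfl⟩

variable [Algebra B A] [Module B Q] [IsScalarTower B A Q]

/-- The graded pieces are the quotients of Q₀ by an ascending chain of submodules. The chain
stabilizes, so finitely many pieces occur up to isomorphism and one denominator works for all. Lifts
of their independent sets, moved to level k by φ^k, form the required set. -/
theorem GenericallyFree.of_filtration [IsDomain B] [IsNoetherian A Q₀]
    (h0 : ∀ k, GenericallyFree B (Q₀ ⧸ filtrationKernel φ Q₀ k))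
    (hQ : ∀ q, ∃ k, q ∈ powFiltration φ Q₀ k) : GenericallyFree B Q := by
  classical
  obtain ⟨N, hN⟩ := monotone_stabilizes_iff_noetherian.2 ‹IsNoetherian A Q₀›
    ⟨filtrationKernel φ Q₀, filtrationKernel_mono φ Q₀⟩
  choose g hg s hs hspan using h0
  have hmin (k : ℕ) : filtrationKernel φ Q₀ (min k N) = filtrationKernel φ Q₀ k := by
    rcases le_total k N with h | h
    · rw [min_eq_left h]
    · rw [min_eq_right h]; exact hN k h
  set G : B := ∏ k ∈ Finset.range (N + 1), g k
  have hG : G ≠ 0 := Finset.prod_ne_zero_iff.2 fun k _ => hg k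
  have key (k : ℕ) : ∃ t : Set Q₀,
      LinearIndependent B (fun x : t => (Submodule.Quotient.mk (x : Q₀) :
        Q₀ ⧸ filtrationKernel φ Q₀ k)) ∧
      ∀ q : Q₀, ∃ m : ℕ, ∃ q' ∈ Submodule.span B t, G ^ m • q - q' ∈ filtrationKernel φ Q₀ k := by
    rw [← hmin k]
    set k' := min k N
    have hk' : k' ∈ Finset.range (N + 1) := Finset.mem_range.2 (by omega)
    refine ⟨Quotient.out '' (s k'), ?_, fun q => ?_⟩
    · have h1 : LinearIndepOn B (fun x : Q₀ => (Submodule.Quotient.mk x :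
          Q₀ ⧸ filtrationKernel φ Q₀ k')) (Quotient.out '' (s k')) := by
        refine LinearIndepOn.image_of_comp Quotient.out _ ?_
        refine (hs k').congr fun x _ => ?_
        exact (Quotient.out_eq x).symm
      exact h1
    · obtain ⟨m, hm⟩ := hspan k' (Submodule.Quotient.mk q)
      have h2 : ∀ x ∈ Submodule.span B (s k'), ∃ q' ∈ Submodule.span B
          (Quotient.out '' (s k') : Set Q₀), (Submodule.Quotient.mk q' : Q₀ ⧸ filtrationKernel φ Q₀ k') = x := by
        intro x hx
        induction hx using Submodule.span_induction with
        | mem x hx => exact ⟨_, Submodule.subset_span ⟨x, hx, rfl⟩, Quotient.out_eq x⟩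
        | zero => exact ⟨0, zero_mem _, rfl⟩
        | add x y _ _ hx hy =>
          obtain ⟨a, ha, rfl⟩ := hx
          obtain ⟨b, hb, rfl⟩ := hy
          exact ⟨a + b, add_mem ha hb, rfl⟩
        | smul b x _ hx =>
          obtain ⟨a, ha, rfl⟩ := hx
          exact ⟨b • a, Submodule.smul_mem _ _ ha, rfl⟩
      have h3 : G ^ m • (Submodule.Quotient.mk q : Q₀ ⧸ filtrationKernel φ Q₀ k') ∈
          Submodule.span B (s k') := by
        have : G ^ m = (∏ j ∈ (Finset.range (N + 1)).erase k', g j) ^ m * g k' ^ m := by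
          rw [← mul_pow, Finset.prod_erase_mul _ _ hk']
        rw [this, mul_smul]
        exact Submodule.smul_mem _ _ hm
      obtain ⟨q', hq', h4⟩ := h2 _ h3
      refine ⟨m, q', hq', ?_⟩
      rw [← Submodule.Quotient.mk_eq_zero, Submodule.Quotient.mk_sub, h4]
      exact sub_self _
  choose t ht htspan using key
  let v : (Σ k, t k) → Q := fun x => (φ ^ x.1) (x.2 : Q₀)
  have hφ (k : ℕ) (b : B) (q : Q) : (φ ^ k) (b • q) = b • (φ ^ k) q :=
    LinearMap.map_smul_of_tower _ b q
  -- Independence in the k-th graded piece: a combination of level-k vectors that falls into the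
  -- previous filtration step is trivial.
  have hvtop (k : ℕ) (l : t k →₀ B)
      (h : (l.sum fun x b => b • v ⟨k, x⟩) ∈ powFiltration φ Q₀ k) : l = 0 := by
    refine linearIndependent_iff.1 (ht k) l ?_
    have h1 : (l.sum fun x b => b • (x : Q₀)) ∈ filtrationKernel φ Q₀ k := by
      rw [mem_filtrationKernel]
      convert h
      simp only [Finsupp.sum, v, AddSubmonoidClass.coe_finsetSum, map_sum]
      exact Finset.sum_congr rfl fun x _ => hφ k _ _
    rw [← Submodule.Quotient.mk_eq_zero] at h1
    rw [Finsupp.linearCombination_apply, ← h1]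
    exact (map_sum ((filtrationKernel φ Q₀ k).mkQ.restrictScalars B) _ _).symm
  have hv : LinearIndependent B v := by
    rw [linearIndependent_iff]
    intro l hl
    -- Peel off the highest level of a relation: the lower levels put its top part into the previous
    -- filtration step.
    have claim : ∀ n, (∀ k ≥ n, l.split k = 0) → l = 0 := by
      intro n
      induction n with
      | zero =>
        intro h
        ext ⟨k, x⟩
        exact DFunLike.congr_fun (h k (Nat.zero_le _)) x
      | succ n ih =>
        intro h
        refine ih fun k hk => ?_
        rcases eq_or_lt_of_le hk with rfl | hk
        · refine hvtop n _ ?_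
          rw [Finsupp.linearCombination_apply, Finsupp.sigma_sum] at hl
          by_cases hn : n ∈ l.splitSupport
          · rw [← Finset.add_sum_erase _ _ hn, add_eq_zero_iff_eq_neg] at hl
            rw [hl]
            refine neg_mem (sum_mem fun k hk => ?_)
            rw [Finset.mem_erase] at hk
            have hkn : k < n := by
              by_contra hkn
              have : l.split k = 0 := h k (by omega)
              exact (Finsupp.mem_splitSupport_iff_nonzero _ _).1 hk.2 this
            refine Submodule.sum_mem _ fun x _ => ?_
            change _ • v ⟨k, x⟩ ∈ _
            rw [← algebraMap_smul A]
            exact Submodule.smul_mem _ _ (pow_mem_powFiltration φ Q₀ hkn x.1.2)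
          · have : l.split n = 0 := by
              by_contra h'
              exact hn ((Finsupp.mem_splitSupport_iff_nonzero _ _).2 h')
            rw [this]
            simp
        · exact h k hk
    refine claim (l.splitSupport.sup id + 1) fun k hk => ?_
    by_contra h'
    have h1 := (Finsupp.mem_splitSupport_iff_nonzero _ _).2 h'
    have : k ≤ _ := Finset.le_sup (f := id) h1
    omega
  refine ⟨G, hG, Set.range v, hv.linearIndepOn_id, fun q => ?_⟩
  obtain ⟨k, hk⟩ := hQ q
  induction k generalizing q with
  | zero =>
    have : q = 0 := hk
    exact ⟨0, by simp [this]⟩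
  | succ k ih =>
    obtain ⟨w, hw, _, ⟨q0, hq0, rfl⟩, rfl⟩ := Submodule.mem_sup.1 hk
    obtain ⟨m, q', hq', h⟩ := htspan k ⟨q0, hq0⟩
    -- After clearing denominators, the top part differs from a combination of the chosen vectors by
    -- an element of lower level, to which induction applies.
    have h1 : G ^ m • w + (φ ^ k) (G ^ m • q0 - q') ∈ powFiltration φ Q₀ k := by
      refine add_mem ?_ h
      rw [← algebraMap_smul A]
      exact Submodule.smul_mem _ _ hw
    obtain ⟨m', h2⟩ := ih _ h1
    have h3 : (φ ^ k) q' ∈ Submodule.span B (Set.range v) := by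
      clear h h1 h2
      induction hq' using Submodule.span_induction with
      | mem x hx => exact Submodule.subset_span ⟨⟨k, ⟨x, hx⟩⟩, rfl⟩
      | zero => simp
      | add x y _ _ hx hy => rw [Submodule.coe_add, map_add]; exact add_mem hx hy
      | smul b x _ hx =>
        have : ((b • x : Q₀) : Q) = b • (x : Q) := rfl
        rw [this, hφ]; exact Submodule.smul_mem _ _ hx
    refine ⟨m' + m, ?_⟩
    have h4 := add_mem h2 (Submodule.smul_mem _ (G ^ m') h3)
    rw [← smul_add, map_sub, hφ, add_assoc, sub_add_cancel, ← smul_add, smul_smul, ← pow_add] at h4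
    exact h4

end Filtration

/-- Apply the filtration lemma with φ multiplication by X and Q₀ the A-span of finitely many
A[X]-generators. -/
theorem FiniteModulesGenericallyFree.polynomial [IsDomain B] {A : Type*} [CommRing A] [Algebra B A]
    [IsNoetherianRing A] (h : FiniteModulesGenericallyFree.{u} B A) :
    FiniteModulesGenericallyFree.{u} B (Polynomial A) := by
  intro Q _ _ _ _ _
  let _ : Module A Q := Module.compHom Q (Polynomial.C : A →+* Polynomial A)
  have hsmul (a : A) (q : Q) : a • q = Polynomial.C a • q := rfl
  have : IsScalarTower B A Q := ⟨fun b a q => by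
    rw [hsmul, hsmul, ← Polynomial.smul_C, smul_assoc]⟩
  let φ : Q →ₗ[A] Q :=
    { toFun := fun q => (Polynomial.X : Polynomial A) • q
      map_add' := smul_add _
      map_smul' := fun a q => by
        simp only [hsmul, RingHom.id_apply, smul_smul, Polynomial.X_mul_C] }
  obtain ⟨s, hs⟩ := (Module.Finite.fg_top : (⊤ : Submodule (Polynomial A) Q).FG)
  let Q₀ : Submodule A Q := Submodule.span A s
  have : Module.Finite A Q₀ := Module.Finite.span_finset A s
  refine GenericallyFree.of_filtration φ Q₀ (fun k => h _) fun q => ?_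
  have hq : q ∈ Submodule.span (Polynomial A) (s : Set Q) := by rw [hs]; trivial
  induction hq using Submodule.span_induction with
  | mem q hq => exact ⟨1, Submodule.mem_sup_right ⟨q, Submodule.subset_span hq, by simp⟩⟩
  | zero => exact ⟨0, zero_mem _⟩
  | add q q' _ _ h1 h2 =>
    obtain ⟨k, hk⟩ := h1
    obtain ⟨k', hk'⟩ := h2
    exact ⟨max k k', add_mem (powFiltration_mono φ Q₀ (le_max_left _ _) hk)
      (powFiltration_mono φ Q₀ (le_max_right _ _) hk')⟩
  | smul f q _ h1 =>
    obtain ⟨k, hk⟩ := h1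
    have hX : ∀ j, ((Polynomial.X : Polynomial A) ^ j) • q ∈ powFiltration φ Q₀ (k + j) := by
      intro j
      induction j with
      | zero => simpa using hk
      | succ j ih =>
        rw [pow_succ', mul_smul]
        exact map_powFiltration_le φ Q₀ (k + j) ⟨_, ih, rfl⟩
    refine ⟨k + f.natDegree, ?_⟩
    have e : f • q = ∑ j ∈ Finset.range (f.natDegree + 1),
        (Polynomial.C (f.coeff j) * Polynomial.X ^ j) • q := by
      conv_lhs => rw [f.as_sum_range_C_mul_X_pow, Finset.sum_smul]
    rw [e]
    refine Submodule.sum_mem _ fun j hj => ?_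
    rw [mul_smul, ← hsmul]
    rw [Finset.mem_range] at hj
    exact Submodule.smul_mem _ _ (powFiltration_mono φ Q₀ (by omega) (hX j))

theorem FiniteModulesGenericallyFree.mvPolynomial [IsDomain B] [IsNoetherianRing B] (n : ℕ) :
    FiniteModulesGenericallyFree.{u} B (MvPolynomial (Fin n) B) := by
  induction n with
  | zero =>
    intro Q _ _ _ _ _
    have : Module.Finite B (MvPolynomial (Fin 0) B) :=
      Module.Finite.equiv (MvPolynomial.isEmptyAlgEquiv B (Fin 0)).symm.toLinearEquiv
    have : Module.Finite B Q := Module.Finite.trans (MvPolynomial (Fin 0) B) Q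
    exact .of_finite
  | succ n ih =>
    exact .of_surjective (MvPolynomial.finSuccEquiv B n).symm.toAlgHom
      (MvPolynomial.finSuccEquiv B n).symm.surjective ih.polynomial

/-- Generic freeness. -/
theorem FiniteModulesGenericallyFree.of_finiteType [IsDomain B] [IsNoetherianRing B] (A : Type*) [CommRing A]
    [Algebra B A] [Algebra.FiniteType B A] : FiniteModulesGenericallyFree.{u} B A := by
  obtain ⟨n, f, hf⟩ := Algebra.FiniteType.iff_quotient_mvPolynomial''.1 ‹Algebra.FiniteType B A›
  exact .of_surjective f hf (.mvPolynomial n)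

end GenericFreeness

/-! ### Kernels under specialization -/

section Specialization

variable {B : Type*} [CommRing B] {R : Type*} [CommRing R] [Algebra B R] {N : Type*}
  [AddCommGroup N] [Module R N] [Module B N] [IsScalarTower B R N]

theorem mem_of_pow_smul_mem {I : Ideal B} {g h : B} (hg : 1 - h * g ∈ I) {T : Submodule B N} {x : N}
    (hx : x ∈ T) {k : ℕ} (hk : g ^ k • x ∈ I • T) : x ∈ I • T := by
  have h1 : 1 - h ^ k * g ^ k ∈ I := by
    rw [← Ideal.Quotient.eq_zero_iff_mem] at hg ⊢
    rw [map_sub, sub_eq_zero, map_one] at hg ⊢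
    rw [← mul_pow, map_pow, ← hg, one_pow]
  have h2 := add_mem (Submodule.smul_mem_smul h1 hx) (Submodule.smul_mem _ (h ^ k) hk)
  rwa [sub_smul, one_smul, smul_smul, sub_add_cancel] at h2

/-- If `N / T` is generically free over `B`, then `T ∩ I N = I T` for all ideals `I` modulo which
a certain nonzero element is invertible. -/
theorem GenericallyFree.exists_mem_smul_of_mem_smul_top (T : Submodule R N)
    (hT : GenericallyFree B (N ⧸ T)) :
    ∃ g : B, g ≠ 0 ∧ ∀ I : Ideal B, (∃ h, 1 - h * g ∈ I) → ∀ x ∈ T,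
      x ∈ I • (⊤ : Submodule B N) → x ∈ I • T.restrictScalars B := by
  obtain ⟨g, hg, s, hs, hspan⟩ := hT
  refine ⟨g, hg, fun I ⟨h, hh⟩ x hxT hx => ?_⟩
  let v : s → N := fun q => Quotient.out (q : N ⧸ T)
  have hv (q : s) : T.mkQ (v q) = q := Quotient.out_eq _
  have hlift : ∀ q ∈ Submodule.span B s, ∃ w ∈ Submodule.span B (Set.range v), T.mkQ w = q := by
    intro q hq
    induction hq using Submodule.span_induction with
    | mem q hq => exact ⟨_, Submodule.subset_span ⟨⟨q, hq⟩, rfl⟩, hv ⟨q, hq⟩⟩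
    | zero => exact ⟨0, zero_mem _, rfl⟩
    | add q q' _ _ h1 h2 =>
      obtain ⟨w, hw, rfl⟩ := h1
      obtain ⟨w', hw', rfl⟩ := h2
      exact ⟨w + w', add_mem hw hw', rfl⟩
    | smul b q _ h1 =>
      obtain ⟨w, hw, rfl⟩ := h1
      exact ⟨b • w, Submodule.smul_mem _ _ hw, rfl⟩
  have key : ∃ k, g ^ k • x ∈ I • T.restrictScalars B ⊔ I • Submodule.span B (Set.range v) := by
    refine Submodule.smul_induction_on hx (fun a ha n _ => ?_) fun x y hx hy => ?_
    · obtain ⟨k, hk⟩ := hspan (T.mkQ n)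
      obtain ⟨w, hw, hw'⟩ := hlift _ hk
      refine ⟨k, ?_⟩
      have h1 : g ^ k • n - w ∈ T := by
        rw [← Submodule.Quotient.mk_eq_zero, Submodule.Quotient.mk_sub, sub_eq_zero]
        exact hw'.symm
      rw [smul_comm, ← sub_add_cancel (g ^ k • n) w, smul_add]
      exact Submodule.add_mem_sup (Submodule.smul_mem_smul ha h1) (Submodule.smul_mem_smul ha hw)
    · obtain ⟨k, hk⟩ := hx
      obtain ⟨l, hl⟩ := hy
      refine ⟨k + l, ?_⟩
      rw [smul_add]
      refine add_mem ?_ ?_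
      · rw [add_comm, pow_add, mul_smul]; exact Submodule.smul_mem _ _ hk
      · rw [pow_add, mul_smul]; exact Submodule.smul_mem _ _ hl
  obtain ⟨k, hk⟩ := key
  obtain ⟨t, ht, w, hw, htw⟩ := Submodule.mem_sup.1 hk
  obtain ⟨a, ha, rfl⟩ := (Submodule.mem_ideal_smul_span_iff_exists_sum I v w).1 hw
  have htT : t ∈ T := (Submodule.smul_le_right : _ ≤ T.restrictScalars B) ht
  have hxT' : g ^ k • x ∈ T.restrictScalars B := Submodule.smul_mem _ _ hxT
  have hwT : (a.sum fun i c => c • v i) ∈ T := by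
    rw [← add_sub_cancel_left t (a.sum fun i c => c • v i), htw]
    exact sub_mem hxT' htT
  -- The part outside T is a combination of lifts of independent elements of N ⧸ T that itself lies
  -- in T, so its coefficients vanish.
  have ha0 : a = 0 := by
    refine linearIndependent_iff.1 hs a ?_
    rw [← Submodule.Quotient.mk_eq_zero] at hwT
    rw [Finsupp.linearCombination_apply, ← hwT]
    refine Eq.trans ?_ (map_sum (T.mkQ.restrictScalars B) _ _).symm
    refine Finset.sum_congr rfl fun i _ => ?_
    rw [map_smul]
    exact congrArg (a i • ·) (hv i).symm
  rw [ha0, Finsupp.sum_zero_index, add_zero] at htw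
  rw [htw] at ht
  exact mem_of_pow_smul_mem hh hxT ht

/-- The kernel of an endomorphism of a specialization has a basis obtained by specializing
generators of the generic kernel. -/
theorem finite_and_finrank_ker_of_specialization {K : Type*} [Field K] {ev : B →+* K}
    (hev : Function.Surjective ev) (Y : N →ₗ[B] N) {N' : Type*} [AddCommGroup N'] [Module K N']
    (Y' : N' →ₗ[K] N') (π : N →ₛₗ[ev] N') (hπ : Function.Surjective π)
    (hker : ∀ x, π x = 0 → x ∈ RingHom.ker ev • (⊤ : Submodule B N))
    (hY : ∀ x, π (Y x) = Y' (π x))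
    (hrange : ∀ x ∈ LinearMap.range Y, x ∈ RingHom.ker ev • (⊤ : Submodule B N) →
      x ∈ RingHom.ker ev • LinearMap.range Y)
    (hkerY : ∀ x ∈ LinearMap.ker Y, x ∈ RingHom.ker ev • (⊤ : Submodule B N) →
      x ∈ RingHom.ker ev • LinearMap.ker Y)
    {g : B} (hg : ev g ≠ 0) {ι : Type*} [Fintype ι] (v : ι → N) (hv : LinearIndependent B v)
    (hvY : ∀ i, Y (v i) = 0)
    (hspan : ∀ x, Y x = 0 → ∃ k : ℕ, g ^ k • x ∈ Submodule.span B (Set.range v)) :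
    Module.Finite K (LinearMap.ker Y') ∧
      Module.finrank K (LinearMap.ker Y') = Fintype.card ι := by
  have hI : ∀ x ∈ RingHom.ker ev • (⊤ : Submodule B N), π x = 0 := by
    intro x hx
    refine Submodule.smul_induction_on hx (fun a ha n _ => ?_) fun x y hx hy => ?_
    · rw [map_smulₛₗ, (RingHom.mem_ker).1 ha, zero_smul]
    · rw [map_add, hx, hy, add_zero]
  let w : ι → LinearMap.ker Y' := fun i => ⟨π (v i), by
    rw [LinearMap.mem_ker, ← hY, hvY, map_zero]⟩
  have hw : LinearIndependent K w := by
    rw [Fintype.linearIndependent_iff]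
    intro a ha
    choose b hb using fun i => hev (a i)
    set z := ∑ i, b i • v i
    have hzY : z ∈ LinearMap.ker Y := by simp [z, hvY]
    have hz : π z = 0 := by
      have := congrArg Subtype.val ha
      simp only [AddSubmonoidClass.coe_finsetSum, Submodule.coe_smul, ZeroMemClass.coe_zero] at this
      simp only [z, map_sum, map_smulₛₗ, hb]
      exact this
    -- A relation among the specialized vectors lifts to z in ker Y ∩ IN = I ker Y, where I = ker
    -- `ev`. Comparing coefficients in the independent family gives g^k b_i ∈ I, hence a_i = 0.
    have key : ∃ k, g ^ k • z ∈ RingHom.ker ev • Submodule.span B (Set.range v) := by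
      refine Submodule.smul_induction_on (hkerY z hzY (hker z hz)) (fun c hc n hn => ?_)
        fun x y hx hy => ?_
      · obtain ⟨k, hk⟩ := hspan n hn
        exact ⟨k, by rw [smul_comm]; exact Submodule.smul_mem_smul hc hk⟩
      · obtain ⟨k, hk⟩ := hx
        obtain ⟨l, hl⟩ := hy
        refine ⟨k + l, ?_⟩
        rw [smul_add]
        refine add_mem ?_ ?_
        · rw [add_comm, pow_add, mul_smul]; exact Submodule.smul_mem _ _ hk
        · rw [pow_add, mul_smul]; exact Submodule.smul_mem _ _ hl
    obtain ⟨k, hk⟩ := key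
    obtain ⟨e, he, hez⟩ := (Submodule.mem_ideal_smul_span_iff_exists_sum _ v _).1 hk
    rw [Finsupp.sum_fintype _ _ (by simp), Finset.smul_sum, ← sub_eq_zero,
      ← Finset.sum_sub_distrib] at hez
    simp only [smul_smul, ← sub_smul] at hez
    intro i
    have h1 := Fintype.linearIndependent_iff.1 hv _ hez i
    have h2 := (RingHom.mem_ker).1 (he i)
    rw [sub_eq_zero.1 h1, map_mul, map_pow, hb] at h2
    exact (mul_eq_zero.1 h2).resolve_left (pow_ne_zero _ hg)
  have hwspan : ⊤ ≤ Submodule.span K (Set.range w) := by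
    rintro ⟨x, hx⟩ -
    obtain ⟨n, rfl⟩ := hπ x
    -- Since im Y ∩ IN = I im Y = Y(IN), the lift n can be changed by an element of IN, without
    -- changing its specialization, into the generic kernel.
    have h1 : Y n ∈ RingHom.ker ev • LinearMap.range Y :=
      hrange _ ⟨n, rfl⟩ (hker _ (by rw [hY]; exact hx))
    rw [LinearMap.range_eq_map, ← Submodule.map_smul''] at h1
    obtain ⟨m, hm, hmn⟩ := h1
    have h2 : Y (n - m) = 0 := by rw [map_sub, hmn, sub_self]
    obtain ⟨k, hk⟩ := hspan _ h2
    have h3 : ∀ q ∈ Submodule.span B (Set.range v), π q ∈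
        (Submodule.span K (Set.range w)).map (LinearMap.ker Y').subtype := by
      intro q hq
      induction hq using Submodule.span_induction with
      | mem q hq =>
        obtain ⟨i, rfl⟩ := hq
        exact ⟨w i, Submodule.subset_span ⟨i, rfl⟩, rfl⟩
      | zero => rw [map_zero]; exact zero_mem _
      | add q q' _ _ h1 h2 => rw [map_add]; exact add_mem h1 h2
      | smul b q _ h1 => rw [map_smulₛₗ]; exact Submodule.smul_mem _ _ h1
    have h4 := h3 _ hk
    rw [map_smulₛₗ, map_pow, Submodule.smul_mem_iff _ (pow_ne_zero k hg), map_sub, hI m hm,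
      sub_zero] at h4
    obtain ⟨⟨y, hy⟩, hyw, hyn⟩ := h4
    have : (⟨π n, hx⟩ : LinearMap.ker Y') = ⟨y, hy⟩ := Subtype.ext hyn.symm
    rw [this]
    exact hyw
  let b := Module.Basis.mk hw hwspan
  exact ⟨Module.Finite.of_basis b, Module.finrank_eq_card_basis b⟩

/-- The dimension of the kernel of an endomorphism is generically constant, if the generic kernel
is finitely generated over the base. -/
theorem exists_finrank_ker_eq_of_specialization [IsDomain B] [IsNoetherianRing B]
    [Algebra.FiniteType B R] [Module.Finite R N] (Y : N →ₗ[R] N)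
    [Module.Finite B (LinearMap.ker Y)] (K : Type*) [Field K] :
    ∃ g : B, g ≠ 0 ∧ ∃ d : ℕ, ∀ (N' : Type u) [AddCommGroup N'] [Module K N'] (ev : B →+* K)
      (Y' : N' →ₗ[K] N') (π : N →ₛₗ[ev] N'), Function.Surjective ev → Function.Surjective π →
      (∀ x, π x = 0 → x ∈ RingHom.ker ev • (⊤ : Submodule B N)) →
      (∀ x, π (Y x) = Y' (π x)) → ev g ≠ 0 →
      Module.Finite K (LinearMap.ker Y') ∧ Module.finrank K (LinearMap.ker Y') = d := by
  have hR : IsNoetherianRing R := Algebra.FiniteType.isNoetherianRing B R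
  have hGF := fun (Q : Type _) [AddCommGroup Q] [Module R Q] [Module B Q] [IsScalarTower B R Q]
    [Module.Finite R Q] => FiniteModulesGenericallyFree.of_finiteType (B := B) R Q
  obtain ⟨g1, hg1, h1⟩ :=
    (hGF (N ⧸ LinearMap.range Y)).exists_mem_smul_of_mem_smul_top
  obtain ⟨g2, hg2, h2⟩ :=
    (hGF (N ⧸ LinearMap.ker Y)).exists_mem_smul_of_mem_smul_top
  obtain ⟨g3, hg3, s, hs, hspan⟩ := GenericallyFree.of_finite (B := B) (Q := LinearMap.ker Y)
  have hfin : Finite s := hs.finite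
  have := Fintype.ofFinite s
  -- The factors guarantee the intersection property for the image, the same for the kernel, and
  -- spanning by s after inverting g3.
  refine ⟨g1 * g2 * g3, mul_ne_zero (mul_ne_zero hg1 hg2) hg3, Fintype.card s, ?_⟩
  intro N' _ _ ev Y' π hev hπ hker hY hg
  simp only [map_mul, mul_ne_zero_iff] at hg
  have hinv (g : B) (hg : ev g ≠ 0) : ∃ h, 1 - h * g ∈ RingHom.ker ev := by
    obtain ⟨h, hh⟩ := hev (ev g)⁻¹
    exact ⟨h, by rw [RingHom.mem_ker, map_sub, map_mul, hh, map_one, inv_mul_cancel₀ hg, sub_self]⟩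
  refine finite_and_finrank_ker_of_specialization hev (Y.restrictScalars B) Y' π hπ hker hY
    (h1 _ (hinv g1 hg.1.1)) (h2 _ (hinv g2 hg.1.2)) hg.2 (fun q : s => ((q : LinearMap.ker Y) : N))
    ?_ (fun q => (q : LinearMap.ker Y).2) ?_
  · exact LinearIndependent.map' hs ((LinearMap.ker Y).subtype.restrictScalars B)
      (LinearMap.ker_eq_bot.2 Subtype.val_injective)
  · intro x hx
    obtain ⟨k, hk⟩ := hspan ⟨x, hx⟩
    refine ⟨k, ?_⟩
    have := Submodule.mem_map_of_mem (f := (LinearMap.ker Y).subtype.restrictScalars B) hk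
    rw [Submodule.map_span] at this
    have e : Set.range (fun q : s => ((q : LinearMap.ker Y) : N)) =
      ((LinearMap.ker Y).subtype.restrictScalars B) '' s := by
        ext; simp
    rw [e]
    exact this

end Specialization

/-! ### Finiteness of the generic kernel -/

section Finiteness

/-- If `c x + Y'` annihilates `a`, and there is a locally nilpotent operator `D` with `D c = 1`
which commutes with `x` and `Y'`, then a power of `x` annihilates `a`. -/
theorem exists_pow_smul_eq_zero {R N : Type*} [CommRing R] [AddCommGroup N] [Module R N]
    (D : N →+ N) {x c Y' : R} (hc : ∀ a : N, D (c • a) = a) (hx : ∀ a : N, D (x • a) = x • D a)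
    (hY' : ∀ a : N, D (Y' • a) = Y' • D a) {a : N} (hD : ∃ k, D^[k] a = 0)
    (ha : (c * x + Y') • a = 0) : ∃ k, x ^ k • a = 0 := by
  obtain ⟨k, hk⟩ := hD
  -- Apply D repeatedly to the relation (c x + Y') a = 0. Each factor x raises the order of D, so
  -- nilpotency on a bounds the power needed.
  have h1 (j : ℕ) : x • D^[j] a = - Y' • D^[j + 1] a := by
    induction j with
    | zero =>
      have := congrArg D ha
      rw [add_smul, map_add, mul_smul, hc, hY', map_zero] at this
      rw [neg_smul]
      exact eq_neg_of_add_eq_zero_left this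
    | succ j ih =>
      have := congrArg D ih
      rw [hx, neg_smul, map_neg, hY', ← neg_smul] at this
      rwa [← Function.iterate_succ_apply' D, ← Function.iterate_succ_apply' D] at this
  have h2 : ∀ j ≤ k, x ^ j • D^[k - j] a = 0 := by
    intro j hj
    induction j with
    | zero => simpa using hk
    | succ j ih =>
      rw [pow_succ, mul_smul, h1, smul_comm, show k - (j + 1) + 1 = k - j by omega, ih (by omega),
        smul_zero]
  exact ⟨k, by simpa using h2 k le_rfl⟩

/-- A finitely generated module over a finitely generated algebra is finite over the base, if
its elements are annihilated by powers of the generators of the algebra. -/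
theorem finite_of_pow_smul_eq_zero {B R N : Type*} [CommRing B] [CommRing R] [Algebra B R]
    [AddCommGroup N] [Module R N] [Module B N] [IsScalarTower B R N] [Module.Finite R N]
    {s : Set R} (hsfin : s.Finite) (hs : Algebra.adjoin B s = ⊤)
    (h : ∀ x ∈ s, ∀ a : N, ∃ k : ℕ, x ^ k • a = 0) : Module.Finite B N := by
  let J := Module.annihilator R N
  have hnil : ∀ x ∈ s, ∃ k, x ^ k ∈ J := by
    intro x hx
    obtain ⟨t, ht⟩ := (Module.Finite.fg_top : (⊤ : Submodule R N).FG)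
    choose k hk using h x hx
    refine ⟨t.sup k, Module.mem_annihilator.2 fun a => ?_⟩
    have ha : a ∈ Submodule.span R (t : Set N) := by rw [ht]; trivial
    induction ha using Submodule.span_induction with
    | mem a ha =>
      rw [← Nat.sub_add_cancel (Finset.le_sup (f := k) ha), pow_add, mul_smul, hk, smul_zero]
    | zero => simp
    | add a b _ _ ha hb => rw [smul_add, ha, hb, add_zero]
    | smul r a _ ha => rw [smul_comm, ha, smul_zero]
  have hft : Algebra.FiniteType B R :=
    ⟨⟨hsfin.toFinset, by rwa [Set.Finite.coe_toFinset]⟩⟩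
  -- The generators are nilpotent modulo the annihilator, so R ⧸ J is integral and of finite type,
  -- hence finite, over B.
  have hint : Algebra.IsIntegral B (R ⧸ J) := by
    refine ⟨fun r => ?_⟩
    obtain ⟨r, rfl⟩ := Ideal.Quotient.mk_surjective r
    have hr : r ∈ Algebra.adjoin B s := by rw [hs]; trivial
    have : Algebra.adjoin B s ≤
        (integralClosure B (R ⧸ J)).comap (Ideal.Quotient.mkₐ B J) := by
      refine Algebra.adjoin_le fun x hx => ?_
      obtain ⟨k, hk⟩ := hnil x hx
      change IsIntegral B (Ideal.Quotient.mk J x)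
      refine IsIntegral.of_pow (n := k + 1) (Nat.succ_pos k) ?_
      rw [← map_pow, Ideal.Quotient.eq_zero_iff_mem.2 (by
        rw [pow_succ]; exact Ideal.mul_mem_right _ _ hk)]
      exact isIntegral_zero
    exact this hr
  have hft' : Algebra.FiniteType B (R ⧸ J) :=
    hft.of_surjective (Ideal.Quotient.mkₐ B J) Ideal.Quotient.mk_surjective
  have hfin : Module.Finite B (R ⧸ J) := Algebra.IsIntegral.finite
  let _ : Module (R ⧸ J) N := Module.quotientAnnihilator
  have : IsScalarTower R (R ⧸ J) N := ⟨fun r q a => by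
    obtain ⟨q, rfl⟩ := Ideal.Quotient.mk_surjective q
    exact mul_smul r q a⟩
  have : IsScalarTower B (R ⧸ J) N := ⟨fun b q a => by
    obtain ⟨q, rfl⟩ := Ideal.Quotient.mk_surjective q
    exact smul_assoc b q a⟩
  have : Module.Finite (R ⧸ J) N := Module.Finite.of_restrictScalars_finite R _ _
  exact Module.Finite.trans (R ⧸ J) N

end Finiteness

/-! ### Generic linear forms and their specializations -/

namespace GenericForms

open MvPolynomial TensorProduct

section Shift

variable {τ S : Type*} [CommRing S]

/-- Division by a variable, discarding the remainder, as a linear map. -/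
noncomputable def shift (t : τ) : MvPolynomial τ S →ₗ[S] MvPolynomial τ S where
  toFun f := f.divMonomial (Finsupp.single t 1)
  map_add' f g := add_divMonomial f g _
  map_smul' a f := by
    ext m
    simp [coeff_divMonomial]

theorem coeff_shift (t : τ) (f : MvPolynomial τ S) (m : τ →₀ ℕ) :
    coeff m (shift t f) = coeff (Finsupp.single t 1 + m) f := coeff_divMonomial _ _ _

/-- This exact one-sided inverse, valid in any characteristic, is why division is used rather than
the partial derivative, whose Leibniz rule would add a term. -/
theorem shift_X_mul_self (t : τ) (f : MvPolynomial τ S) : shift t (X t * f) = f := by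
  ext m
  rw [coeff_shift, coeff_X_mul]

theorem shift_X_mul_of_ne {s t : τ} (h : s ≠ t) (f : MvPolynomial τ S) :
    shift t (X s * f) = X s * shift t f := by
  classical
  ext m
  rw [coeff_shift, coeff_X_mul', coeff_X_mul', coeff_shift]
  have h1 : s ∈ (Finsupp.single t 1 + m).support ↔ s ∈ m.support := by
    simp [h.symm]
  simp only [h1]
  split_ifs with h2
  · congr 1
    rw [add_tsub_assoc_of_le]
    rw [Finsupp.single_le_iff]
    exact Nat.one_le_iff_ne_zero.2 (Finsupp.mem_support_iff.1 h2)
  · rfl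

theorem coeff_iterate_shift (t : τ) (f : MvPolynomial τ S) (k : ℕ) (m : τ →₀ ℕ) :
    coeff m ((shift t)^[k] f) = coeff (Finsupp.single t k + m) f := by
  induction k generalizing m with
  | zero => simp
  | succ k ih =>
    rw [Function.iterate_succ_apply', coeff_shift, ih, ← add_assoc, ← Finsupp.single_add]

theorem exists_iterate_shift_eq_zero (t : τ) (f : MvPolynomial τ S) :
    ∃ k, (shift t)^[k] f = 0 := by
  refine ⟨f.totalDegree + 1, ?_⟩
  ext m
  rw [coeff_iterate_shift, coeff_zero]
  refine coeff_eq_zero_of_totalDegree_lt ?_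
  refine lt_of_lt_of_le (Nat.lt_succ_self _) ?_
  have h : (Finsupp.single t (f.totalDegree + 1) + m) t ≤
      (Finsupp.single t (f.totalDegree + 1) + m).degree := Finsupp.le_degree _ _
  have h2 : f.totalDegree + 1 ≤ (Finsupp.single t (f.totalDegree + 1) + m) t := by simp
  exact h2.trans h

end Shift

section Module

variable {τ S : Type*} [CommRing S] (M : Type*) [AddCommGroup M] [Module S M]

/-- The module `M[τ]` of polynomials with coefficients in `M`. -/
abbrev PolyModule (τ S : Type*) [CommRing S] (M : Type*) [AddCommGroup M] [Module S M] : Type _ :=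
  MvPolynomial τ S ⊗[S] M

/-- `shift` on polynomials with coefficients in `M`. -/
noncomputable def moduleShift (t : τ) : PolyModule τ S M →ₗ[S] PolyModule τ S M :=
  (shift t).rTensor M

variable {M}

theorem moduleShift_smul {t : τ} {r : MvPolynomial τ S} (hr : ∀ f, shift t (r * f) = r * shift t f)
    (z : PolyModule τ S M) : moduleShift M t (r • z) = r • moduleShift M t z := by
  induction z using TensorProduct.induction_on with
  | zero => simp
  | tmul f m =>
    simp only [moduleShift, smul_tmul', smul_eq_mul, LinearMap.rTensor_tmul, hr]
  | add x y hx hy => simp only [smul_add, map_add, hx, hy]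

theorem moduleShift_X_smul (t : τ) (z : PolyModule τ S M) :
    moduleShift M t ((X t : MvPolynomial τ S) • z) = z := by
  induction z using TensorProduct.induction_on with
  | zero => simp
  | tmul f m =>
    simp only [moduleShift, smul_tmul', smul_eq_mul, LinearMap.rTensor_tmul, shift_X_mul_self]
  | add x y hx hy => simp only [smul_add, map_add, hx, hy]

theorem exists_iterate_moduleShift_eq_zero (t : τ) (z : PolyModule τ S M) :
    ∃ k, (moduleShift M t)^[k] z = 0 := by
  have h0 : ∀ (z : PolyModule τ S M) (k l : ℕ), k ≤ l → (moduleShift M t)^[k] z = 0 →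
      (moduleShift M t)^[l] z = 0 := by
    intro z k l hkl h
    rw [← Nat.sub_add_cancel hkl, Function.iterate_add_apply, h, Function.iterate_fixed (map_zero _)]
  induction z using TensorProduct.induction_on with
  | zero => exact ⟨0, rfl⟩
  | tmul f m =>
    obtain ⟨k, hk⟩ := exists_iterate_shift_eq_zero t f
    refine ⟨k, ?_⟩
    have : ∀ k, (moduleShift M t)^[k] (f ⊗ₜ[S] m) = ((shift t)^[k] f) ⊗ₜ[S] m := by
      intro k
      induction k with
      | zero => rfl
      | succ k ih =>
        rw [Function.iterate_succ_apply', ih, Function.iterate_succ_apply']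
        rfl
    rw [this, hk, zero_tmul]
  | add x y hx hy =>
    obtain ⟨k, hk⟩ := hx
    obtain ⟨l, hl⟩ := hy
    refine ⟨max k l, ?_⟩
    rw [iterate_map_add, h0 x k _ (le_max_left _ _) hk, h0 y l _ (le_max_right _ _) hl, add_zero]

variable (M) in
/-- Evaluation of polynomials with coefficients in `M`. -/
noncomputable def moduleEval (a : τ → S) : PolyModule τ S M →ₗ[S] M :=
  TensorProduct.lift (LinearMap.lsmul S M ∘ₗ (aeval a : MvPolynomial τ S →ₐ[S] S).toLinearMap)

theorem moduleEval_tmul (a : τ → S) (f : MvPolynomial τ S) (m : M) :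
    moduleEval M a (f ⊗ₜ m) = eval a f • m := rfl

theorem moduleEval_smul (a : τ → S) (f : MvPolynomial τ S) (z : PolyModule τ S M) :
    moduleEval M a (f • z) = eval a f • moduleEval M a z := by
  induction z using TensorProduct.induction_on with
  | zero => simp
  | tmul g m => rw [smul_tmul', smul_eq_mul, moduleEval_tmul, moduleEval_tmul, map_mul, mul_smul]
  | add x y hx hy => simp only [smul_add, map_add, hx, hy]

theorem moduleEval_surjective (a : τ → S) : Function.Surjective (moduleEval M a) := fun m =>
  ⟨1 ⊗ₜ m, by rw [moduleEval_tmul, map_one, one_smul]⟩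

end Module

section Generic

variable {K : Type u} [Field K] {n : ℕ} {M : Type u} [AddCommGroup M]
  [Module (MvPolynomial (Fin n) K) M]

attribute [local instance] MvPolynomial.algebraMvPolynomial

variable (K) in
/-- The generic linear forms. -/
noncomputable def genericForm (p : Fin n) :
    MvPolynomial (Fin n × Fin n) (MvPolynomial (Fin n) K) :=
  ∑ q, X (p, q) * C (X q)

theorem eval_genericForm (c : Fin n × Fin n → K) (p : Fin n) :
    eval (fun t => C (c t)) (genericForm K p) = linearForms c p := by
  simp [genericForm, linearForms]

theorem shift_C_mul {τ S : Type*} [CommRing S] (t : τ) (a : S) (f : MvPolynomial τ S) :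
    shift t (C a * f) = C a * shift t f := by
  rw [← smul_eq_C_mul, map_smul, smul_eq_C_mul]

theorem shift_sum_mul {p r : Fin n} {q : Fin n} {s : Finset (Fin n)} (h : ∀ q' ∈ s, (r, q') ≠ (p, q))
    (f : MvPolynomial (Fin n × Fin n) (MvPolynomial (Fin n) K)) :
    shift (p, q) ((∑ q' ∈ s, X (r, q') * C (X q')) * f) =
      (∑ q' ∈ s, X (r, q') * C (X q')) * shift (p, q) f := by
  rw [Finset.sum_mul, map_sum, Finset.sum_mul]
  refine Finset.sum_congr rfl fun q' hq' => ?_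
  rw [mul_assoc, shift_X_mul_of_ne (h q' hq'), shift_C_mul, mul_assoc]

theorem shift_genericForm_mul {p r : Fin n} (h : r ≠ p) (q : Fin n)
    (f : MvPolynomial (Fin n × Fin n) (MvPolynomial (Fin n) K)) :
    shift (p, q) (genericForm K r * f) = genericForm K r * shift (p, q) f :=
  shift_sum_mul (fun _ _ h' => h (congrArg Prod.fst h')) f

variable (K M) in
/-- The quotient of `M[c]` by the first generic linear forms. -/
abbrev GenericQuotient (p : Fin n) : Type u :=
  PolyModule (Fin n × Fin n) (MvPolynomial (Fin n) K) M ⧸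
    initialSubmodule (PolyModule (Fin n × Fin n) (MvPolynomial (Fin n) K) M) (genericForm K) p

/-- The earlier generic forms do not involve the coefficients of row p, so division by c_{pq}
commutes with them and descends to the quotient. -/
theorem moduleShift_mem_initialSubmodule (p q : Fin n)
    {z : PolyModule (Fin n × Fin n) (MvPolynomial (Fin n) K) M}
    (hz : z ∈ initialSubmodule _ (genericForm K) p) :
    moduleShift M (p, q) z ∈ initialSubmodule _ (genericForm K) p := by
  refine Submodule.smul_induction_on hz (fun a ha z hz => ?_) fun x y hx hy => ?_
  · clear hz
    induction ha using Submodule.span_induction generalizing z with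
    | zero => simp
    | add a b _ _ ha hb => rw [add_smul, map_add]; exact add_mem (ha z) (hb z)
    | smul r a _ ha => rw [smul_eq_mul, mul_comm, mul_smul]; exact ha _
    | mem a ha =>
      obtain ⟨r, hr, rfl⟩ := ha
      rw [moduleShift_smul (shift_genericForm_mul (ne_of_lt hr) q)]
      exact Submodule.smul_mem_smul (Ideal.subset_span ⟨r, hr, rfl⟩) trivial
  · rw [map_add]; exact add_mem hx hy

variable (M) in
/-- The operator induced by `moduleShift` on a generic quotient. -/
noncomputable def quotientShift (p q : Fin n) : GenericQuotient K M p →+ GenericQuotient K M p :=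
  QuotientAddGroup.map _ _ (moduleShift M (p, q)).toAddMonoidHom
    fun _ hz => moduleShift_mem_initialSubmodule p q hz

theorem quotientShift_mk (p q : Fin n) (z : PolyModule (Fin n × Fin n) (MvPolynomial (Fin n) K) M) :
    quotientShift M p q (Submodule.Quotient.mk z) =
      (Submodule.Quotient.mk (moduleShift M (p, q) z) : GenericQuotient K M p) := rfl

/-- Write the p-th generic form as c_{pq} x_q plus terms free of c_{pq}; division by c_{pq} is the
locally nilpotent operator of `exists_pow_smul_eq_zero`. -/
theorem exists_pow_C_X_smul_eq_zero (p q : Fin n) {a : GenericQuotient K M p}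
    (ha : genericForm K p • a = 0) :
    ∃ k, (C (X q) : MvPolynomial (Fin n × Fin n) (MvPolynomial (Fin n) K)) ^ k • a = 0 := by
  have hmk : Function.Surjective (Submodule.Quotient.mk : _ → GenericQuotient K M p) :=
    Submodule.Quotient.mk_surjective _
  refine exists_pow_smul_eq_zero (quotientShift M p q) (c := X (p, q)) (x := C (X q))
    (Y' := ∑ q' ∈ Finset.univ.erase q, X (p, q') * C (X q')) ?_ ?_ ?_ ?_ ?_
  · intro a
    obtain ⟨z, rfl⟩ := hmk a
    rw [← Submodule.Quotient.mk_smul, quotientShift_mk, moduleShift_X_smul]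
  · intro a
    obtain ⟨z, rfl⟩ := hmk a
    rw [← Submodule.Quotient.mk_smul, quotientShift_mk, quotientShift_mk,
      moduleShift_smul (shift_C_mul _ _), Submodule.Quotient.mk_smul]
  · intro a
    obtain ⟨z, rfl⟩ := hmk a
    rw [← Submodule.Quotient.mk_smul, quotientShift_mk, quotientShift_mk,
      moduleShift_smul (shift_sum_mul fun q' hq' h =>
        (Finset.mem_erase.1 hq').1 (congrArg Prod.snd h)), Submodule.Quotient.mk_smul]
  · obtain ⟨z, rfl⟩ := hmk a
    obtain ⟨k, hk⟩ := exists_iterate_moduleShift_eq_zero (p, q) z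
    refine ⟨k, ?_⟩
    have : ∀ k, (quotientShift M p q)^[k] (Submodule.Quotient.mk z) =
        Submodule.Quotient.mk ((moduleShift M (p, q))^[k] z) := by
      intro k
      induction k with
      | zero => rfl
      | succ k ih =>
        rw [Function.iterate_succ_apply', ih, Function.iterate_succ_apply', quotientShift_mk]
    rw [this, hk, Submodule.Quotient.mk_zero]
  · rwa [Finset.add_sum_erase _ (fun q' => X (p, q') * C (X q')) (Finset.mem_univ q)]

theorem adjoin_C_X_eq_top :
    Algebra.adjoin (MvPolynomial (Fin n × Fin n) K) (Set.range fun q : Fin n =>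
      (C (X q) : MvPolynomial (Fin n × Fin n) (MvPolynomial (Fin n) K))) = ⊤ := by
  refine eq_top_iff.2 fun f _ => ?_
  have hmap (b : MvPolynomial (Fin n × Fin n) K) : MvPolynomial.map C b ∈
      Algebra.adjoin (MvPolynomial (Fin n × Fin n) K) (Set.range fun q : Fin n =>
      (C (X q) : MvPolynomial (Fin n × Fin n) (MvPolynomial (Fin n) K))) :=
    Subalgebra.algebraMap_mem _ b
  induction f using MvPolynomial.induction_on with
  | C s =>
    induction s using MvPolynomial.induction_on with
    | C a => simpa using hmap (C a)
    | add s s' hs hs' => rw [C_add]; exact add_mem (hs trivial) (hs' trivial)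
    | mul_X s q hs =>
      rw [C_mul]; exact mul_mem (hs trivial) (Algebra.subset_adjoin ⟨q, rfl⟩)
  | add f g hf hg => exact add_mem (hf trivial) (hg trivial)
  | mul_X f t hf => exact mul_mem (hf trivial) (by simpa using hmap (X t))

theorem moduleEval_mem_initialSubmodule (c : Fin n × Fin n → K) (p : Fin n)
    {z : PolyModule (Fin n × Fin n) (MvPolynomial (Fin n) K) M}
    (hz : z ∈ initialSubmodule _ (genericForm K) p) :
    moduleEval M (fun t => C (c t)) z ∈ initialSubmodule M (linearForms c) p := by
  refine Submodule.smul_induction_on hz (fun a ha z hz => ?_) fun x y hx hy => ?_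
  · rw [moduleEval_smul]
    refine Submodule.smul_mem_smul ?_ trivial
    have h := Ideal.mem_map_of_mem (eval fun t => (C (c t) : MvPolynomial (Fin n) K)) ha
    rw [Ideal.map_span, Set.image_image] at h
    simpa only [eval_genericForm] using h
  · rw [map_add]; exact add_mem hx hy

variable (M) in
/-- Specialization of a generic quotient. -/
noncomputable def specialize (c : Fin n × Fin n → K) (p : Fin n) :
    GenericQuotient K M p →+ M ⧸ initialSubmodule M (linearForms c) p :=
  QuotientAddGroup.map _ _ (moduleEval M fun t => C (c t)).toAddMonoidHom
    fun _ hz => moduleEval_mem_initialSubmodule c p hz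

theorem specialize_mk (c : Fin n × Fin n → K) (p : Fin n)
    (z : PolyModule (Fin n × Fin n) (MvPolynomial (Fin n) K) M) :
    specialize M c p (Submodule.Quotient.mk z) =
      Submodule.Quotient.mk (moduleEval M (fun t => C (c t)) z) := rfl

theorem specialize_smul (c : Fin n × Fin n → K) (p : Fin n)
    (f : MvPolynomial (Fin n × Fin n) (MvPolynomial (Fin n) K)) (a : GenericQuotient K M p) :
    specialize M c p (f • a) = eval (fun t => C (c t)) f • specialize M c p a := by
  obtain ⟨z, rfl⟩ : ∃ z, (Submodule.Quotient.mk z : GenericQuotient K M p) = a :=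
    Submodule.Quotient.mk_surjective _ a
  rw [← Submodule.Quotient.mk_smul, specialize_mk, moduleEval_smul]
  rfl

theorem specialize_surjective (c : Fin n × Fin n → K) (p : Fin n) :
    Function.Surjective (specialize M c p) := by
  intro a
  obtain ⟨m, rfl⟩ := Submodule.Quotient.mk_surjective _ a
  obtain ⟨z, rfl⟩ := moduleEval_surjective (fun t => (C (c t) : MvPolynomial (Fin n) K)) m
  exact ⟨Submodule.Quotient.mk z, rfl⟩

/-- The kernel of the evaluation of `M[c]` at a point is generated by the polynomials vanishing
there. -/
theorem mem_of_moduleEval_eq_zero (c : Fin n × Fin n → K)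
    (H : AddSubgroup (PolyModule (Fin n × Fin n) (MvPolynomial (Fin n) K) M))
    (hH : ∀ b : MvPolynomial (Fin n × Fin n) K, eval c b = 0 →
      ∀ z : PolyModule (Fin n × Fin n) (MvPolynomial (Fin n) K) M,
        (MvPolynomial.map C b : MvPolynomial (Fin n × Fin n) (MvPolynomial (Fin n) K)) • z ∈ H)
    {z : PolyModule (Fin n × Fin n) (MvPolynomial (Fin n) K) M}
    (hz : moduleEval M (fun t => C (c t)) z = 0) : z ∈ H := by
  -- Modulo H each indeterminate may be replaced by its value, so every tensor is congruent to 1 ⊗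
  -- its evaluation.
  have h1 (f : MvPolynomial (Fin n × Fin n) (MvPolynomial (Fin n) K)) (m : M) :
      f ⊗ₜ[MvPolynomial (Fin n) K] m - 1 ⊗ₜ (eval (fun t => C (c t)) f • m) ∈ H := by
    induction f using MvPolynomial.induction_on generalizing m with
    | C s =>
      rw [eval_C, ← smul_tmul, smul_eq_C_mul, mul_one, sub_self]
      exact zero_mem _
    | add f g hf hg =>
      rw [add_tmul, map_add, add_smul, tmul_add]
      convert add_mem (hf m) (hg m) using 1
      exact add_sub_add_comm _ _ _ _
    | mul_X f t hf =>
      have h2 := hH (X t - C (c t)) (by simp) (f ⊗ₜ m)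
      have h3 := hf ((C (c t) : MvPolynomial (Fin n) K) • m)
      have h4 := add_mem h2 h3
      convert h4 using 1
      have e1 : (f * X t) ⊗ₜ[MvPolynomial (Fin n) K] m =
          (X t : MvPolynomial (Fin n × Fin n) (MvPolynomial (Fin n) K)) •
            f ⊗ₜ[MvPolynomial (Fin n) K] m := by
        rw [smul_tmul', smul_eq_mul, mul_comm]
      have e2 : f ⊗ₜ[MvPolynomial (Fin n) K] ((C (c t) : MvPolynomial (Fin n) K) • m) =
          (C (C (c t)) : MvPolynomial (Fin n × Fin n) (MvPolynomial (Fin n) K)) •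
            f ⊗ₜ[MvPolynomial (Fin n) K] m := by
        rw [← smul_tmul, smul_tmul', smul_eq_mul, smul_eq_C_mul]
      have e3 : (MvPolynomial.map C (X t - C (c t)) :
          MvPolynomial (Fin n × Fin n) (MvPolynomial (Fin n) K)) = X t - C (C (c t)) := by
        rw [map_sub, map_X, map_C]
      have e4 := sub_smul (X t) (C (C (c t)) : MvPolynomial (Fin n × Fin n) (MvPolynomial (Fin n) K))
        (f ⊗ₜ[MvPolynomial (Fin n) K] m)
      rw [e1, e2, e3, map_mul, eval_X, mul_smul]
      refine Eq.trans ?_ (congrArg₂ (· + ·) e4.symm rfl)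
      exact (sub_add_sub_cancel _ _ _).symm
  have h2 (z : PolyModule (Fin n × Fin n) (MvPolynomial (Fin n) K) M) :
      z - 1 ⊗ₜ moduleEval M (fun t => C (c t)) z ∈ H := by
    induction z using TensorProduct.induction_on with
    | zero => simp
    | tmul f m => exact h1 f m
    | add x y hx hy =>
      rw [map_add, tmul_add]
      convert add_mem hx hy using 1
      exact add_sub_add_comm _ _ _ _
  simpa [hz] using h2 z

/-- Evaluation maps the generic initial submodule onto the specialized one, so any representative
can be corrected to evaluate to zero. -/
theorem exists_moduleEval_eq_zero (c : Fin n × Fin n → K) (p : Fin n) {a : GenericQuotient K M p}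
    (ha : specialize M c p a = 0) :
    ∃ z, (Submodule.Quotient.mk z : GenericQuotient K M p) = a ∧
      moduleEval M (fun t => C (c t)) z = 0 := by
  obtain ⟨z, rfl⟩ : ∃ z, (Submodule.Quotient.mk z : GenericQuotient K M p) = a :=
    Submodule.Quotient.mk_surjective _ a
  rw [specialize_mk, Submodule.Quotient.mk_eq_zero] at ha
  have key : ∀ m ∈ initialSubmodule M (linearForms c) p,
      ∃ u ∈ initialSubmodule (PolyModule (Fin n × Fin n) (MvPolynomial (Fin n) K) M)
        (genericForm K) p, moduleEval M (fun t => (C (c t) : MvPolynomial (Fin n) K)) u = m := by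
    intro m hm
    refine Submodule.smul_induction_on hm (fun s hs m _ => ?_) fun x y hx hy => ?_
    · have hs' : s ∈ (Ideal.span (genericForm K '' {q | q < p})).map
          (eval fun t => (C (c t) : MvPolynomial (Fin n) K)) := by
        rw [Ideal.map_span, Set.image_image]
        simpa only [eval_genericForm] using hs
      obtain ⟨r, hr, rfl⟩ := (Ideal.mem_map_iff_of_surjective _
        (fun a => ⟨C a, eval_C a⟩)).1 hs'
      exact ⟨r • ((1 : MvPolynomial (Fin n × Fin n) (MvPolynomial (Fin n) K)) ⊗ₜ m), Submodule.smul_mem_smul hr trivial, by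
        rw [moduleEval_smul, moduleEval_tmul, map_one, one_smul]⟩
    · obtain ⟨u, hu, rfl⟩ := hx
      obtain ⟨w, hw, rfl⟩ := hy
      exact ⟨u + w, add_mem hu hw, map_add _ _ _⟩
  obtain ⟨u, hu, huz⟩ := key _ ha
  refine ⟨z - u, ?_, by rw [map_sub, huz, sub_self]⟩
  rw [Submodule.Quotient.mk_sub, (Submodule.Quotient.mk_eq_zero _).2 hu, sub_zero]

end Generic

/-! ### Annihilator modules and generic constancy of their dimension -/

section Annihilator

variable {R : Type*} [CommRing R] {M : Type*} [AddCommGroup M] [Module R M] {n : ℕ}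

/-- The annihilator module as the kernel of a multiplication. -/
noncomputable def annihilatorModuleEquivKer (y : Fin n → R) (p : Fin n) :
    annihilatorModule M y p ≃ₗ[R]
      LinearMap.ker (LinearMap.lsmul R (M ⧸ initialSubmodule M y p) (y p)) := by
  let f : colonSubmodule M y p →ₗ[R] M ⧸ initialSubmodule M y p :=
    (initialSubmodule M y p).mkQ ∘ₗ (colonSubmodule M y p).subtype
  refine (Submodule.quotEquivOfEq _ (LinearMap.ker f) ?_).trans
    (f.quotKerEquivRange.trans (LinearEquiv.ofEq _ _ ?_))
  · ext ⟨m, hm⟩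
    exact (Submodule.Quotient.mk_eq_zero (initialSubmodule M y p) (x := m)).symm
  · ext x
    obtain ⟨m, rfl⟩ := Submodule.Quotient.mk_surjective _ x
    have h : (Submodule.Quotient.mk m : M ⧸ initialSubmodule M y p) ∈
        LinearMap.ker (LinearMap.lsmul R (M ⧸ initialSubmodule M y p) (y p)) ↔
        m ∈ colonSubmodule M y p := by
      rw [LinearMap.mem_ker, LinearMap.lsmul_apply, ← Submodule.Quotient.mk_smul,
        Submodule.Quotient.mk_eq_zero]
      rfl
    constructor
    · rintro ⟨⟨m', hm'⟩, hx⟩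
      rw [← hx, LinearMap.mem_ker, LinearMap.lsmul_apply]
      change (Submodule.Quotient.mk (y p • m') : M ⧸ initialSubmodule M y p) = 0
      rw [Submodule.Quotient.mk_eq_zero]
      exact hm'
    · exact fun hx => ⟨⟨m, h.1 hx⟩, rfl⟩

variable (K : Type*) [Field K] [Algebra K R] [Module K M] [IsScalarTower K R M]

/-- `annihilatorModuleEquivKer` over a ground field. -/
noncomputable def annihilatorModuleEquivKerOver (y : Fin n → R) (p : Fin n) :
    annihilatorModule M y p ≃ₗ[K]
      LinearMap.ker ((LinearMap.lsmul R (M ⧸ initialSubmodule M y p) (y p)).restrictScalars K) :=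
  let e := (annihilatorModuleEquivKer (M := M) y p).restrictScalars K
  e

end Annihilator

section Main

/-- The dimension of the kernel of a multiplication is generically constant, if the elements of the
generic kernel are annihilated by powers of the generators of the algebra. -/
theorem exists_finrank_ker_smul_eq {B R : Type*} [CommRing B] [IsDomain B] [IsNoetherianRing B]
    [CommRing R] [Algebra B R] {s : Set R} (hsfin : s.Finite) (hs : Algebra.adjoin B s = ⊤)
    {N : Type*} [AddCommGroup N] [Module R N] [Module.Finite R N] {y : R}
    (hnil : ∀ x ∈ s, ∀ a : N, y • a = 0 → ∃ k : ℕ, x ^ k • a = 0) (K : Type*) [Field K] :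
    ∃ g : B, g ≠ 0 ∧ ∃ d : ℕ, ∀ (N' : Type u) [AddCommGroup N'] [Module K N'] (ev : B →+* K)
      (Y' : N' →ₗ[K] N') (π : N →+ N'), Function.Surjective ev → Function.Surjective π →
      (∀ b a, π (algebraMap B R b • a) = ev b • π a) →
      (∀ H : AddSubgroup N, (∀ b, ev b = 0 → ∀ a, algebraMap B R b • a ∈ H) →
        ∀ a, π a = 0 → a ∈ H) →
      (∀ a, π (y • a) = Y' (π a)) → ev g ≠ 0 →
      Module.Finite K (LinearMap.ker Y') ∧ Module.finrank K (LinearMap.ker Y') = d := by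
  let _ : Module B N := Module.compHom N (algebraMap B R)
  have hB (b : B) (a : N) : b • a = algebraMap B R b • a := rfl
  have : IsScalarTower B R N := ⟨fun b r a => by rw [hB, Algebra.smul_def, mul_smul]⟩
  have : Algebra.FiniteType B R :=
    ⟨⟨hsfin.toFinset, by rwa [Set.Finite.coe_toFinset]⟩⟩
  have : IsNoetherianRing R := Algebra.FiniteType.isNoetherianRing B R
  -- The kernel is finitely generated over the Noetherian ring R, and powers of the algebra
  -- generators kill its elements.
  have : Module.Finite B (LinearMap.ker (LinearMap.lsmul R N y)) := by
    refine finite_of_pow_smul_eq_zero (R := R) hsfin hs fun x hx ⟨a, ha⟩ => ?_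
    obtain ⟨k, hk⟩ := hnil x hx a ha
    exact ⟨k, Subtype.ext hk⟩
  obtain ⟨g, hg, d, h⟩ :=
    exists_finrank_ker_eq_of_specialization.{u} (B := B) (LinearMap.lsmul R N y) K
  refine ⟨g, hg, d, fun N' _ _ ev Y' π hev hπ hsmul hker hY hgc => ?_⟩
  refine h N' ev Y' { π with map_smul' := hsmul } hev hπ (fun a ha => ?_) hY hgc
  exact hker (RingHom.ker ev • (⊤ : Submodule B N)).toAddSubgroup
    (fun b hb a => Submodule.smul_mem_smul (N := (⊤ : Submodule B N)) (n := a) hb trivial) a ha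

variable {K : Type u} [Field K] {n : ℕ} (M : Type u) [AddCommGroup M] [Module K M]
  [Module (MvPolynomial (Fin n) K) M] [IsScalarTower K (MvPolynomial (Fin n) K) M]

attribute [local instance] MvPolynomial.algebraMvPolynomial

/-- Generic annihilator numbers are well defined. -/
theorem exists_isGenericAnnihilatorNumber [Module.Finite (MvPolynomial (Fin n) K) M] (p : Fin n) :
    ∃ a, IsGenericAnnihilatorNumber K n M p a := by
  obtain ⟨g, hg, d, h⟩ := exists_finrank_ker_smul_eq.{u}
    (B := MvPolynomial (Fin n × Fin n) K) (N := GenericQuotient K M p) (y := genericForm K p)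
    (Set.finite_range _) adjoin_C_X_eq_top (by
      rintro _ ⟨q, rfl⟩ a ha
      exact exists_pow_C_X_smul_eq_zero p q ha) K
  refine ⟨d, g, hg, fun c hc => ?_⟩
  let Y' : (M ⧸ initialSubmodule M (linearForms c) p) →ₗ[K]
      (M ⧸ initialSubmodule M (linearForms c) p) :=
    (LinearMap.lsmul (MvPolynomial (Fin n) K) _ (linearForms c p)).restrictScalars K
  have hsmul : ∀ (b : MvPolynomial (Fin n × Fin n) K) (a : GenericQuotient K M p),
      specialize M c p (algebraMap (MvPolynomial (Fin n × Fin n) K)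
        (MvPolynomial (Fin n × Fin n) (MvPolynomial (Fin n) K)) b • a) =
      eval c b • specialize M c p a := by
    intro b a
    have e : eval (fun t => C (c t)) (MvPolynomial.map C b :
        MvPolynomial (Fin n × Fin n) (MvPolynomial (Fin n) K)) =
        (C (eval c b) : MvPolynomial (Fin n) K) := by
      rw [MvPolynomial.eval_map]
      exact (eval₂_comp C c b).symm
    refine (specialize_smul c p _ a).trans ?_
    rw [MvPolynomial.algebraMap_def]
    refine (congrArg (· • specialize M c p a) e).trans ?_
    rw [← algebraMap_eq, algebraMap_smul]
  have hker : ∀ H : AddSubgroup (GenericQuotient K M p),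
      (∀ b : MvPolynomial (Fin n × Fin n) K, eval c b = 0 → ∀ a,
        algebraMap (MvPolynomial (Fin n × Fin n) K) (MvPolynomial (Fin n × Fin n) (MvPolynomial (Fin n) K)) b • a ∈ H) →
      ∀ a, specialize M c p a = 0 → a ∈ H := by
    intro H hH a ha
    obtain ⟨z, rfl, hz⟩ := exists_moduleEval_eq_zero c p ha
    refine mem_of_moduleEval_eq_zero c (H.comap (Submodule.mkQ _).toAddMonoidHom)
      (fun b hb w => ?_) hz
    have := hH b hb (Submodule.Quotient.mk w)
    rwa [MvPolynomial.algebraMap_def, ← Submodule.Quotient.mk_smul] at this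
  have hY : ∀ a, specialize M c p (genericForm K p • a) = Y' (specialize M c p a) := by
    intro a
    exact (specialize_smul c p _ a).trans (by rw [eval_genericForm]; rfl)
  obtain ⟨h1, h2⟩ := h (M ⧸ initialSubmodule M (linearForms c) p) (eval c) Y' (specialize M c p)
    (fun a => ⟨C a, eval_C a⟩) (specialize_surjective c p) hsmul hker hY hc
  let e : annihilatorModule M (linearForms c) p ≃ₗ[K] LinearMap.ker Y' :=
    annihilatorModuleEquivKerOver K (linearForms c) p
  exact ⟨Module.Finite.equiv e.symm, e.finrank_eq.trans h2⟩

end Main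

end GenericForms

/-! ### Choice of a generic matrix and conclusion -/

section Main

variable {K : Type u} [Field K] {n : ℕ}

theorem isGenericAnnihilatorNumber_genericAnnihilatorNumber (M : Type u) [AddCommGroup M]
    [Module K M] [Module (MvPolynomial (Fin n) K) M] [IsScalarTower K (MvPolynomial (Fin n) K) M]
    [Module.Finite (MvPolynomial (Fin n) K) M] (p : Fin n) :
    IsGenericAnnihilatorNumber K n M p (genericAnnihilatorNumber K n M p) := by
  have h := GenericForms.exists_isGenericAnnihilatorNumber (K := K) M p
  rw [genericAnnihilatorNumber, dif_pos h]
  exact h.choose_spec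

/-- Finitely many generic properties and the linear independence of the forms hold
simultaneously. -/
theorem exists_forall_and_det_ne_zero [Infinite K] {ι : Type*} [Fintype ι]
    {P : ι → (Fin n × Fin n → K) → Prop} (hP : ∀ j, ForGenericCoeffs (P j)) :
    ∃ c, (∀ j, P j c) ∧ (Matrix.of (Function.curry c)).det ≠ 0 := by
  choose g hg h using hP
  -- Intersecting the open sets means multiplying their equations; the generic determinant adds
  -- invertibility. Over an infinite field the nonzero product has a nonvanishing point.
  have hne : (∏ j, g j) * (Matrix.mvPolynomialX (Fin n) (Fin n) K).det ≠ 0 :=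
    mul_ne_zero (Finset.prod_ne_zero_iff.2 fun j _ => hg j)
      (Matrix.det_mvPolynomialX_ne_zero (Fin n) K)
  obtain ⟨c, hc⟩ : ∃ c, MvPolynomial.eval c
      ((∏ j, g j) * (Matrix.mvPolynomialX (Fin n) (Fin n) K).det) ≠ 0 := by
    by_contra! hc
    exact hne (MvPolynomial.funext fun c => by rw [hc c, map_zero])
  rw [map_mul, map_prod, RingHom.map_det] at hc
  refine ⟨c, fun j => h j c (Finset.prod_ne_zero_iff.1 (left_ne_zero_of_mul hc) j
    (Finset.mem_univ j)), ?_⟩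
  convert right_ne_zero_of_mul hc using 2
  ext a b
  simp [Function.curry]

/-- The summation range may be extended to all indices, as the added binomial coefficients are zero.
-/
theorem bettiBound_succ (M : Type u) [AddCommGroup M]
    [Module K M] [Module (MvPolynomial (Fin n) K) M] [IsScalarTower K (MvPolynomial (Fin n) K) M]
    (i : ℕ) : bettiBound K n M (i + 1) =
      ∑ j : Fin n, (n - ((j : ℕ) + 1)).choose i * genericAnnihilatorNumber K n M j := by
  rw [bettiBound, Finset.sum_filter]
  refine Finset.sum_congr rfl fun j _ => ?_
  split_ifs with h
  · rfl
  · rw [Nat.choose_eq_zero_of_lt (by omega), zero_mul]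

end Main

theorem theorem2p3 {K : Type u} [Field K] [Infinite K] {n : ℕ}
    {M : Type u} [AddCommGroup M] [Module K M] [Module (MvPolynomial (Fin n) K) M]
    [IsScalarTower K (MvPolynomial (Fin n) K) M] [Module.Finite (MvPolynomial (Fin n) K) M]
    (𝓜 : ℤ → Submodule K M) (h_dec : DirectSum.IsInternal 𝓜)
    (h_smul : ∀ (d : ℕ) (j : ℤ) (f : MvPolynomial (Fin n) K) (m : M),
      f.IsHomogeneous d → m ∈ 𝓜 j → f • m ∈ 𝓜 (d + j)) :
    (∀ j : Fin n, IsGenericAnnihilatorNumber K n M j (genericAnnihilatorNumber K n M j)) ∧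
    ∀ i : ℕ, 1 ≤ i → bettiNumber K n M i = bettiBound K n M i →
      ∀ k : ℕ, i ≤ k → bettiNumber K n M k = bettiBound K n M k := by
  have hα := isGenericAnnihilatorNumber_genericAnnihilatorNumber (K := K) (n := n) M
  refine ⟨hα, fun i hi h k hik => ?_⟩
  -- A single matrix realizes all generic annihilator numbers and computes all Betti numbers, so the
  -- claim becomes one about a fixed Koszul complex.
  obtain ⟨c, hc, hdet⟩ := exists_forall_and_det_ne_zero hα
  obtain ⟨i, rfl⟩ := Nat.exists_eq_add_of_le' hi
  obtain ⟨k, rfl⟩ := Nat.exists_eq_add_of_le' (hi.trans hik)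
  simp only [bettiBound_succ, Koszul.bettiNumber_eq_finrank_homology M hdet,
    ← fun j => (hc j).2] at h ⊢
  exact Koszul.finrank_homology_eq_of_le K (linearForms c) (fun j => (hc j).1)
    (Nat.le_of_succ_le_succ hik) h
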